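/- All graphs are finite, simple and undirected. Let $\mathbb F_2$ be the field with two elements. For a graph $G$ on the vertex set $V$, let $S(\mathbb F_2,G)$ be the set of symmetric matrices $A$ over $\mathbb F_2$, with rows and columns indexed by $V$, such that for all $i\ne j$ one has $a_{ij}\neq 0$ if and only if $ij$ is an edge of $G$ (the diagonal entries are arbitrary), and let $$\operatorname{mr}(\mathbb F_2,G)=\min\{\operatorname{rank}A : A\in S(\mathbb F_2,G)\}.$$ Let $\mathcal F_4(\mathbb F_2)$ be the class of minimal forbidden subgraphs for $\{G:\operatorname{mr}(\mathbb F_2,G)\le 3\}$, that is, the class of all graphs $H$ with $\operatorname{mr}(\mathbb F_2,H)\ge 4$ and $\operatorname{mr}(\mathbb F_2,H-v)\le 3$ for every vertex $v$ of $H$. **Theorem.** Up to isomorphism, $\mathcal F_4(\mathbb F_2)$ consists of exactly the 62 graphs listed below, which are pairwise nonisomorphic: a graph belongs to $\mathcal F_4(\mathbb F_2)$ if and only if it is isomorphic to one of them. For every graph $G$ one has $\operatorname{mr}(\mathbb F_2,G)\le 3$ if and only if no graph in $\mathcal F_4(\mathbb F_2)$ is isomorphic to an induced subgraph of $G$; equivalently,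 if and only if none of the 62 listed graphs is isomorphic to an induced subgraph of $G$. The 62 graphs. In each line $n$ is the number of vertices, the vertices are $1,\dots,n$, and the two-digit entry $ab$ denotes the edge joining the vertices $a$ and $b$ (an isolated vertex would appear in no entry; there is none). 1. $n=5$: 12, 23, 34, 45 2. $n=6$: 12, 23, 45, 56 3. $n=6$: 12, 23, 34, 56 4. $n=6$: 12, 23, 24, 45, 46 5. $n=6$: 12, 23, 25, 34, 45, 56 6. $n=6$: 12, 13, 24, 34, 45, 46 7. $n=6$: 12, 23, 24, 34, 35, 46 8. $n=6$: 12, 13, 23, 34, 35, 56 9. $n=6$: 12, 23, 24, 34, 45, 46 10. $n=6$: 12, 13, 24, 34, 35, 45, 46 11. $n=6$: 12, 13, 23, 24, 34, 35, 56 12. $n=6$: 12, 23, 24, 34, 35, 45, 46 13. $n=6$: 13, 23, 24, 34, 35, 45, 46 14. $n=6$: 12, 14, 23, 24, 34, 45, 46 15. $n=6$: 12, 13, 23, 24, 34, 35, 45, 46 16. $n=6$: 12, 13, 23, 24, 34, 35, 36, 45 17. $n=6$: 12, 13, 23, 24, 25, 34, 35, 45, 56 18. $n=6$: 12, 13, 14,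 23, 24, 34, 35, 45, 46 19. $n=6$: 12, 13, 23, 25, 34, 36, 45, 56 20. $n=6$: 12, 13, 23, 24, 35, 45, 46, 56 21. $n=6$: 12, 13, 14, 23, 25, 36, 45, 46, 56 22. $n=6$: 12, 13, 23, 24, 25, 34, 36, 45, 56 23. $n=6$: 12, 13, 23, 24, 34, 35, 45, 46, 56 24. $n=6$: 12, 13, 14, 23, 24, 34, 35, 46, 56 25. $n=6$: 12, 13, 23, 24, 34, 35, 36, 45, 46 26. $n=6$: 12, 13, 14, 23, 25, 34, 36, 45, 46, 56 27. $n=6$: 12, 13, 14, 23, 25, 34, 35, 45, 46, 56 28. $n=6$: 12, 13, 14, 23, 25, 34, 35, 36, 46, 56 29. $n=6$: 12, 13, 23, 24, 25, 34, 35, 36, 45, 56 30. $n=6$: 12, 13, 14, 23, 24, 25, 34, 36, 45, 46, 56 31. $n=6$: 12, 13, 14, 23, 24, 25, 34, 35, 45, 46, 56 32. $n=6$: 12, 13, 14, 23, 24, 25, 34, 35, 36, 45, 46, 56 33. $n=7$: 12, 23, 45, 67 34. $n=7$: 12, 13, 23, 34, 35, 67 35. $n=7$: 12, 13, 23, 24,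 34, 35, 67 36. $n=7$: 12, 13, 14, 23, 24, 34, 35, 45, 67 37. $n=7$: 12, 14, 24, 34, 45, 46, 47, 56 38. $n=7$: 12, 13, 14, 23, 24, 35, 36, 45, 46, 47 39. $n=7$: 12, 13, 14, 23, 24, 34, 35, 45, 56, 57, 67 40. $n=7$: 12, 13, 16, 23, 24, 25, 34, 35, 45, 46, 56, 67 41. $n=7$: 12, 13, 14, 15, 23, 24, 25, 34, 36, 45, 46, 56, 67 42. $n=7$: 12, 13, 14, 15, 23, 24, 26, 34, 35, 36, 45, 46, 56, 67 43. $n=7$: 12, 13, 14, 15, 23, 24, 26, 34, 35, 36, 45, 46, 47, 56 44. $n=7$: 12, 13, 14, 23, 24, 35, 36, 45, 46, 56, 57, 67 45. $n=7$: 12, 13, 14, 23, 24, 35, 36, 37, 45, 46, 47, 56 46. $n=7$: 12, 13, 14, 23, 25, 26, 35, 36, 45, 46, 57, 67 47. $n=7$: 12, 13, 14, 15, 23, 24, 26, 35, 37, 45, 47, 56, 67 48. $n=7$: 12, 13, 14, 23, 25, 26, 34, 35, 36, 45, 46, 57, 67 49. $n=7$: 12, 13, 14, 15, 24, 25, 26,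 34, 35, 36, 46, 47, 56, 57 50. $n=7$: 12, 13, 14, 15, 23, 24, 26, 34, 35, 36, 45, 47, 56, 67 51. $n=7$: 12, 13, 14, 17, 23, 25, 26, 34, 35, 36, 45, 46, 56, 57, 67 52. $n=7$: 12, 13, 14, 15, 23, 24, 25, 26, 34, 35, 36, 45, 47, 57, 67 53. $n=7$: 12, 13, 14, 15, 23, 24, 25, 34, 36, 37, 45, 46, 47, 56, 57, 67 54. $n=7$: 12, 13, 14, 15, 23, 24, 25, 26, 34, 36, 37, 45, 46, 47, 56, 57 55. $n=7$: 12, 13, 14, 15, 23, 24, 25, 26, 34, 35, 36, 45, 46, 47, 56, 57 56. $n=7$: 12, 13, 14, 17, 23, 24, 25, 26, 34, 35, 36, 45, 46, 47, 56, 57, 67 57. $n=7$: 12, 13, 14, 15, 16, 23, 24, 25, 27, 34, 36, 37, 45, 46, 47, 56, 57, 67 58. $n=7$: 12, 13, 14, 15, 16, 23, 24, 25, 26, 34, 35, 37, 45, 46, 47, 56, 57, 67 59. $n=8$: 12, 34, 56, 78 60. $n=8$: 12, 13, 14, 15, 23, 24, 26, 34, 35, 36, 45, 46, 56, 78 61.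 $n=8$: 12, 13, 14, 15, 16, 23, 24, 25, 26, 34, 37, 38, 47, 48, 57, 58, 67, 68 62. $n=8$: 12, 13, 14, 15, 16, 23, 24, 25, 26, 34, 37, 38, 47, 48, 56, 57, 58, 67, 68, 78 -/

import Mathlib

universe u

/-- `symmMatrices F G` is the set `S(F, G)` of symmetric matrices over `F`, indexed by the vertices
of `G`, whose off-diagonal entry at `(i, j)` is nonzero exactly when `i` and `j` are adjacent.
The diagonal is unrestricted. -/
def symmMatrices (F : Type*) [Field F] {V : Type*} (G : SimpleGraph V) : Set (Matrix V V F) :=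
  {A | A.IsSymm ∧ ∀ i j, i ≠ j → (A i j ≠ 0 ↔ G.Adj i j)}

theorem symmMatrices_nonempty (F : Type*) [Field F] {V : Type*} (G : SimpleGraph V) :
    (symmMatrices F G).Nonempty := by
  classical
  refine ⟨G.adjMatrix F, G.isSymm_adjMatrix, fun i j _ => ?_⟩
  by_cases h : G.Adj i j <;> simp [h]

/-- The minimum rank `mr(F, G)`. -/
noncomputable def minRank (F : Type*) [Field F] {V : Type*} [Fintype V] (G : SimpleGraph V) : ℕ :=
  sInf (Matrix.rank '' symmMatrices F G)

/-- The infimum defining `minRank` is attained. -/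
theorem exists_rank_eq_minRank (F : Type*) [Field F] {V : Type*} [Fintype V]
    (G : SimpleGraph V) : ∃ A ∈ symmMatrices F G, A.rank = minRank F G :=
  Nat.sInf_mem ((symmMatrices_nonempty F G).image Matrix.rank)

open scoped Classical in
/-- `G` is a minimal forbidden subgraph for the class of graphs with `mr(F, ·) ≤ k`, that is,
`G ∈ 𝓕_{k+1}(F)`. The graph `G - v` is the subgraph induced on the vertices other than `v`. -/
def IsMinimalForbidden (F : Type*) [Field F] (k : ℕ) {V : Type*} [Fintype V]
    (G : SimpleGraph V) : Prop :=
  k + 1 ≤ minRank F G ∧ ∀ v : V, minRank F (G.induce {w | w ≠ v}) ≤ k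

/-- The graph on `Fin n` described by `(n, E)`, where `n ≤ 9`: its vertices are labelled
`1, ..., n` (the element `i` of `Fin n` has label `i + 1`), and the edge between the vertices
labelled `a < b` is written in `E` as the two-digit number `10 * a + b`. -/
def listedGraph (d : ℕ × List ℕ) : SimpleGraph (Fin d.1) :=
  SimpleGraph.fromRel fun i j => 10 * ((i : ℕ) + 1) + ((j : ℕ) + 1) ∈ d.2

/-- The list of the 62 graphs, each in the form (number of vertices, edges). -/
def forbiddenList : List (ℕ × List ℕ) := [
  (5, [12,23,34,45]),
  (6, [12,23,45,56]),
  (6, [12,23,34,56]),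
  (6, [12,23,24,45,46]),
  (6, [12,23,25,34,45,56]),
  (6, [12,13,24,34,45,46]),
  (6, [12,23,24,34,35,46]),
  (6, [12,13,23,34,35,56]),
  (6, [12,23,24,34,45,46]),
  (6, [12,13,24,34,35,45,46]),
  (6, [12,13,23,24,34,35,56]),
  (6, [12,23,24,34,35,45,46]),
  (6, [13,23,24,34,35,45,46]),
  (6, [12,14,23,24,34,45,46]),
  (6, [12,13,23,24,34,35,45,46]),
  (6, [12,13,23,24,34,35,36,45]),
  (6, [12,13,23,24,25,34,35,45,56]),
  (6, [12,13,14,23,24,34,35,45,46]),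
  (6, [12,13,23,25,34,36,45,56]),
  (6, [12,13,23,24,35,45,46,56]),
  (6, [12,13,14,23,25,36,45,46,56]),
  (6, [12,13,23,24,25,34,36,45,56]),
  (6, [12,13,23,24,34,35,45,46,56]),
  (6, [12,13,14,23,24,34,35,46,56]),
  (6, [12,13,23,24,34,35,36,45,46]),
  (6, [12,13,14,23,25,34,36,45,46,56]),
  (6, [12,13,14,23,25,34,35,45,46,56]),
  (6, [12,13,14,23,25,34,35,36,46,56]),
  (6, [12,13,23,24,25,34,35,36,45,56]),
  (6, [12,13,14,23,24,25,34,36,45,46,56]),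
  (6, [12,13,14,23,24,25,34,35,45,46,56]),
  (6, [12,13,14,23,24,25,34,35,36,45,46,56]),
  (7, [12,23,45,67]),
  (7, [12,13,23,34,35,67]),
  (7, [12,13,23,24,34,35,67]),
  (7, [12,13,14,23,24,34,35,45,67]),
  (7, [12,14,24,34,45,46,47,56]),
  (7, [12,13,14,23,24,35,36,45,46,47]),
  (7, [12,13,14,23,24,34,35,45,56,57,67]),
  (7, [12,13,16,23,24,25,34,35,45,46,56,67]),
  (7, [12,13,14,15,23,24,25,34,36,45,46,56,67]),
  (7, [12,13,14,15,23,24,26,34,35,36,45,46,56,67]),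
  (7, [12,13,14,15,23,24,26,34,35,36,45,46,47,56]),
  (7, [12,13,14,23,24,35,36,45,46,56,57,67]),
  (7, [12,13,14,23,24,35,36,37,45,46,47,56]),
  (7, [12,13,14,23,25,26,35,36,45,46,57,67]),
  (7, [12,13,14,15,23,24,26,35,37,45,47,56,67]),
  (7, [12,13,14,23,25,26,34,35,36,45,46,57,67]),
  (7, [12,13,14,15,24,25,26,34,35,36,46,47,56,57]),
  (7, [12,13,14,15,23,24,26,34,35,36,45,47,56,67]),
  (7, [12,13,14,17,23,25,26,34,35,36,45,46,56,57,67]),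
  (7, [12,13,14,15,23,24,25,26,34,35,36,45,47,57,67]),
  (7, [12,13,14,15,23,24,25,34,36,37,45,46,47,56,57,67]),
  (7, [12,13,14,15,23,24,25,26,34,36,37,45,46,47,56,57]),
  (7, [12,13,14,15,23,24,25,26,34,35,36,45,46,47,56,57]),
  (7, [12,13,14,17,23,24,25,26,34,35,36,45,46,47,56,57,67]),
  (7, [12,13,14,15,16,23,24,25,27,34,36,37,45,46,47,56,57,67]),
  (7, [12,13,14,15,16,23,24,25,26,34,35,37,45,46,47,56,57,67]),
  (8, [12,34,56,78]),
  (8, [12,13,14,15,23,24,26,34,35,36,45,46,56,78]),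
  (8, [12,13,14,15,16,23,24,25,26,34,37,38,47,48,57,58,67,68]),
  (8, [12,13,14,15,16,23,24,25,26,34,37,38,47,48,56,57,58,67,68,78])]

/-! Over 𝔽₂ the graph fixes every off-diagonal entry of a matrix in S(𝔽₂, G); only the diagonal is
free. Pivoting writes a symmetric matrix of rank at most 3 as a sum of squares a aᵀ and hyperbolic
terms b cᵀ + c bᵀ. The isometry ⟨1⟩ ⊥ H ≅ ⟨1⟩³, whose underlying identity still holds for a = 0,
replaces a hyperbolic term and a possibly zero square by three squares. So the matrix is a Gram
matrix of vectors of 𝔽₂³ under the standard product, and mr(𝔽₂, G) ≤ 3 says exactly that the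
vertices can be labelled by vectors of 𝔽₂³ whose products give the adjacencies
(`minRank_le_three_iff`). This property passes to induced subgraphs, so two facts remain: every
nonrepresentable graph contains a listed graph, and each listed graph is nonrepresentable while its
vertex deletions are representable.

The first fact rests on a local-to-global principle (`SearchNode.representable_or_contains`). Let H
be an induced subgraph of G with a fixed representation, and fix a set of vectors, the span, for the
other vertices. If every other vertex is joined to H as some vector of the span is, and any two of
them are adjacent as their vectors prescribe, the representation extends to all of G. A failure is
therefore visible in H together with one or two further vertices, which leaves finitely many
extensions. In each of them `searchNodes` exhibits a copy of a graph further down the same list or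
of one of the 62. Starting from a single vertex and moving down the list, one ends with a
representation of G or with a listed graph. The list is a certificate: how it was found plays no
role, and G need not be finite.

The second fact is a backtracking search over labellings (`hasRep_iff`), and nonisomorphism is seen
from a degree invariant. -/

/-! ### Vectors of 𝔽₂³ as numbers below 8 -/

/-- The standard dot product on `𝔽₂³`, where a vector is given by the binary digits of a number less
than `8`. -/
def dot (x y : ℕ) : Bool := (150 : ℕ).testBit (x &&& y)

/-- The vector of `𝔽₂³` given by the binary digits of `x`. -/
def binaryVec (x : ℕ) : Fin 3 → ZMod 2 := fun i => if x.testBit i then 1 else 0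

/-- The constant in `dot` is 150 = 2¹ + 2² + 2⁴ + 2⁷: its digits mark the numbers below 8 with an
odd number of ones, so it tabulates the parity of `x &&& y`. -/
theorem binaryVec_dotProduct {x y : ℕ} (hx : x < 8) (hy : y < 8) :
    binaryVec x ⬝ᵥ binaryVec y = if dot x y then 1 else 0 := by
  have h : ∀ x < 8, ∀ y < 8, binaryVec x ⬝ᵥ binaryVec y = if dot x y then 1 else 0 := by
    decide +kernel
  exact h x hx y hy

theorem exists_binaryVec_eq (u : Fin 3 → ZMod 2) : ∃ x < 8, binaryVec x = u := by
  revert u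
  decide +kernel

theorem dot_comm (x y : ℕ) : dot x y = dot y x := by
  rw [dot, dot, Nat.land_comm]

/-- A graph is representable if its vertices can be labelled by vectors of `𝔽₂³` such that distinct
vertices are adjacent exactly when their labels are not orthogonal. -/
def Representable {V : Type*} (G : SimpleGraph V) : Prop :=
  ∃ f : V → ℕ, (∀ v, f v < 8) ∧ ∀ v w, v ≠ w → (G.Adj v w ↔ dot (f v) (f w) = true)

theorem Representable.of_embedding {V W : Type*} {G : SimpleGraph V} {H : SimpleGraph W}
    (hG : Representable G) (e : H ↪g G) : Representable H := by
  obtain ⟨f, hf, h⟩ := hG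
  refine ⟨f ∘ e, fun v => hf _, fun v w hvw => ?_⟩
  rw [← e.map_adj_iff]
  exact h _ _ (e.injective.ne hvw)

/-! ### Symmetric matrices of rank at most three over 𝔽₂ as Gram matrices -/

section Gram

open Matrix

variable {V : Type*} [Fintype V]

theorem ZMod.eq_zero_or_eq_one_of_two (a : ZMod 2) : a = 0 ∨ a = 1 := by
  revert a; decide

/-- The rank of `A` exceeds that of `B` if the range of `B` lies in that of `A` and all columns of
`B` vanish in a row where some column of `A` does not. -/
theorem Matrix.rank_lt_rank {F : Type*} [Field F] [DecidableEq V] {A B : Matrix V V F}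
    (hB : LinearMap.range B.mulVecLin ≤ LinearMap.range A.mulVecLin) {i j : V}
    (hBi : ∀ k, B i k = 0) (hA : A i j ≠ 0) : B.rank < A.rank := by
  -- If the ranges were equal, column `j` of `A` would lie in the range of `B`, all of whose
  -- elements vanish at `i`.
  refine Submodule.finrank_lt_finrank_of_lt (lt_of_le_of_ne hB fun h => hA ?_)
  have hj : A *ᵥ Pi.single j 1 ∈ LinearMap.range B.mulVecLin := by
    rw [h]; exact ⟨_, rfl⟩
  obtain ⟨x, hx⟩ := hj
  have := congrFun hx i
  simp only [mulVecLin_apply, mulVec_single_one] at this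
  rw [show A i j = A.col j i from rfl, ← this]
  simp [mulVec, dotProduct, hBi]

/-- Symmetric elimination with the diagonal pivot `A i i = 1`: row `i` becomes zero, and the range
does not grow because the subtracted matrix has all its columns proportional to column `i` of `A`.
-/
theorem Matrix.IsSymm.sub_vecMulVec_self_rank_lt [DecidableEq V] {A : Matrix V V (ZMod 2)}
    (hA : A.IsSymm) {i : V} (hi : A i i = 1) :
    (A - vecMulVec (A i) (A i)).IsSymm ∧ (A - vecMulVec (A i) (A i)).rank < A.rank := by
  have hs : ∀ k l, A k l = A l k := fun k l => hA.apply l k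
  refine ⟨?_, rank_lt_rank (i := i) (j := i) ?_ (fun k => ?_) (by simp [hi])⟩
  · ext k l
    simp [vecMulVec_apply, hs k l, mul_comm]
  · rintro _ ⟨x, rfl⟩
    refine ⟨x - (A i ⬝ᵥ x) • Pi.single i 1, ?_⟩
    ext k
    simp [mulVec_sub, mulVec_smul, vecMulVec_mulVec, hs k i, mul_comm]
  · simp [vecMulVec_apply, hi]

/-- Elimination with the pivot block of zero diagonal and off-diagonal entry 1. The two terms are
removed one at a time: the first clears row `j`, the second row `i`, and each lowers the rank. The
intermediate matrix `C` need not be symmetric, which is why `rank_lt_rank` concerns arbitrary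
matrices. -/
theorem Matrix.IsSymm.sub_hyperbolic_rank_add_two_le [DecidableEq V] {A : Matrix V V (ZMod 2)}
    (hA : A.IsSymm) {i j : V} (hi : A i i = 0) (hj : A j j = 0) (hij : A i j = 1) :
    (A - vecMulVec (A i) (A j) - vecMulVec (A j) (A i)).IsSymm ∧
      (A - vecMulVec (A i) (A j) - vecMulVec (A j) (A i)).rank + 2 ≤ A.rank := by
  have hs : ∀ k l, A k l = A l k := fun k l => hA.apply l k
  set B := A - vecMulVec (A i) (A j) - vecMulVec (A j) (A i) with hB
  set C := A - vecMulVec (A i) (A j) with hC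
  have hji : A j i = 1 := by rw [hs, hij]
  have h1 : B.rank < C.rank := by
    refine rank_lt_rank (i := i) (j := j) ?_ (fun k => ?_) ?_
    · rintro _ ⟨x, rfl⟩
      refine ⟨x - (A i ⬝ᵥ x) • Pi.single j 1, ?_⟩
      ext k
      simp [hB, hC, mulVec_sub, mulVec_smul, vecMulVec_mulVec, vecMulVec_apply, hs k j,
        mul_comm, hj]
      ring
    · simp [hB, hC, vecMulVec_apply, hji, hi]
    · simp [hC, vecMulVec_apply, hij, hi]
  have h2 : C.rank < A.rank := by
    refine rank_lt_rank (i := j) (j := i) ?_ (fun k => ?_) (by simp [hji])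
    · rintro _ ⟨x, rfl⟩
      refine ⟨x - (A j ⬝ᵥ x) • Pi.single i 1, ?_⟩
      ext k
      simp [hC, mulVec_sub, mulVec_smul, vecMulVec_mulVec, hs k i, mul_comm]
    · simp [hC, vecMulVec_apply, hij]
  refine ⟨?_, by omega⟩
  ext k l
  simp [hB, hC, vecMulVec_apply, hs k l, mul_comm]
  ring

theorem Matrix.eq_zero_of_rank_eq_zero {A : Matrix V V (ZMod 2)} (h : A.rank = 0) : A = 0 := by
  classical
  rw [rank, Submodule.finrank_eq_zero, LinearMap.range_eq_bot] at h
  ext i j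
  simpa using congrFun (LinearMap.congr_fun h (Pi.single j 1)) i

/-- A nonzero diagonal entry gives a square. Otherwise the matrix is alternating, cannot be
diagonalised in characteristic 2, and any nonzero entry gives a hyperbolic term. -/
theorem Matrix.IsSymm.exists_eq_vecMulVec_add {A : Matrix V V (ZMod 2)} (hA : A.IsSymm)
    (h0 : A.rank ≠ 0) :
    (∃ (a : V → ZMod 2) (B : Matrix V V (ZMod 2)), B.IsSymm ∧ B.rank + 1 ≤ A.rank ∧
      A = vecMulVec a a + B) ∨
    ∃ (a b : V → ZMod 2) (B : Matrix V V (ZMod 2)), B.IsSymm ∧ B.rank + 2 ≤ A.rank ∧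
      A = vecMulVec a b + vecMulVec b a + B := by
  classical
  by_cases hd : ∃ i, A i i = 1
  · obtain ⟨i, hi⟩ := hd
    obtain ⟨hs, hr⟩ := hA.sub_vecMulVec_self_rank_lt hi
    exact Or.inl ⟨_, _, hs, hr, (add_sub_cancel _ _).symm⟩
  have hd' : ∀ i, A i i = 0 := fun i =>
    (ZMod.eq_zero_or_eq_one_of_two _).resolve_right fun h => hd ⟨i, h⟩
  by_cases ho : ∃ i j, A i j = 1
  · obtain ⟨i, j, hij⟩ := ho
    obtain ⟨hs, hr⟩ := hA.sub_hyperbolic_rank_add_two_le (hd' i) (hd' j) hij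
    exact Or.inr ⟨A i, A j, _, hs, hr, by abel⟩
  · refine absurd ?_ h0
    rw [show A = 0 from ?_, rank_zero]
    ext i j
    exact (ZMod.eq_zero_or_eq_one_of_two _).resolve_right fun h => ho ⟨i, j, h⟩

/-- A symmetric matrix over `𝔽₂` of rank at most `1` is the Gram matrix of a family of scalars. -/
theorem Matrix.IsSymm.exists_eq_vecMulVec {A : Matrix V V (ZMod 2)} (hA : A.IsSymm)
    (h : A.rank ≤ 1) : ∃ a, A = vecMulVec a a := by
  by_cases h0 : A.rank = 0
  · exact ⟨0, by simp [eq_zero_of_rank_eq_zero h0]⟩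
  obtain ⟨a, B, -, hr, rfl⟩ | ⟨a, b, B, -, hr, rfl⟩ := hA.exists_eq_vecMulVec_add h0
  · exact ⟨a, by rw [eq_zero_of_rank_eq_zero (by omega : B.rank = 0), add_zero]⟩
  · omega

/-- The isometry ⟨1⟩ ⊥ H ≅ ⟨1⟩³. For `a = 0` it still expresses a hyperbolic term by three squares.
Entrywise it is an identity in six elements of 𝔽₂. -/
theorem vecMulVec_add_hyperbolic_eq_sum {W : Type*} (a b c : W → ZMod 2) :
    vecMulVec a a + (vecMulVec b c + vecMulVec c b) =
      vecMulVec (a + b) (a + b) + vecMulVec (a + c) (a + c) +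
        vecMulVec (a + b + c) (a + b + c) := by
  ext i j
  simp only [Matrix.add_apply, vecMulVec_apply, Pi.add_apply]
  generalize a i = x, a j = y, b i = z, b j = u, c i = v, c j = w
  revert x y z u v w
  decide

/-- A symmetric matrix over `𝔽₂` of rank at most `3` is the Gram matrix of a family of vectors of
`𝔽₂³` with the standard dot product. -/
theorem Matrix.IsSymm.exists_eq_sum_vecMulVec {A : Matrix V V (ZMod 2)} (hA : A.IsSymm)
    (h : A.rank ≤ 3) :
    ∃ a b c : V → ZMod 2, A = vecMulVec a a + vecMulVec b b + vecMulVec c c := by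
  by_cases h0 : A.rank = 0
  · exact ⟨0, 0, 0, by simp [eq_zero_of_rank_eq_zero h0]⟩
  obtain ⟨a, B, hB, hr, rfl⟩ | ⟨b, c, B, hB, hr, rfl⟩ := hA.exists_eq_vecMulVec_add h0
  · by_cases h1 : B.rank = 0
    · exact ⟨a, 0, 0, by simp [eq_zero_of_rank_eq_zero h1]⟩
    obtain ⟨b, C, hC, hr', rfl⟩ | ⟨b, c, C, hC, hr', rfl⟩ := hB.exists_eq_vecMulVec_add h1
    · obtain ⟨c, rfl⟩ := hC.exists_eq_vecMulVec (by omega)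
      exact ⟨a, b, c, by abel⟩
    · rw [eq_zero_of_rank_eq_zero (by omega : C.rank = 0), add_zero]
      exact ⟨_, _, _, vecMulVec_add_hyperbolic_eq_sum a b c⟩
  -- The remainder has rank at most 1. It may vanish: then `a = 0` is possible and an alternating
  -- matrix of rank 2 uses all three coordinates.
  · obtain ⟨a, rfl⟩ := hB.exists_eq_vecMulVec (by omega)
    rw [add_comm]
    exact ⟨_, _, _, vecMulVec_add_hyperbolic_eq_sum a b c⟩

end Gram

theorem minRank_le_iff (F : Type*) [Field F] {V : Type*} [Fintype V] (G : SimpleGraph V) (k : ℕ) :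
    minRank F G ≤ k ↔ ∃ A ∈ symmMatrices F G, A.rank ≤ k := by
  constructor
  · intro h
    obtain ⟨A, hA, hr⟩ := exists_rank_eq_minRank F G
    exact ⟨A, hA, hr.trans_le h⟩
  · rintro ⟨A, hA, hr⟩
    exact (Nat.sInf_le (Set.mem_image_of_mem _ hA)).trans hr

/-- The rows of the three Gram factors label the vertices. Conversely, if the rows of X are the
labels, X Xᵀ has rank at most 3, the number of columns of X. Since the diagonal is free, the product
of a label with itself imposes nothing. -/
theorem minRank_le_three_iff {V : Type*} [Fintype V] (G : SimpleGraph V) :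
    minRank (ZMod 2) G ≤ 3 ↔ Representable G := by
  rw [minRank_le_iff]
  constructor
  · rintro ⟨A, ⟨hs, hA⟩, hr⟩
    obtain ⟨a, b, c, rfl⟩ := hs.exists_eq_sum_vecMulVec hr
    choose f hf hfv using fun v => exists_binaryVec_eq ![a v, b v, c v]
    refine ⟨f, hf, fun v w hvw => ?_⟩
    have h := binaryVec_dotProduct (hf v) (hf w)
    rw [hfv, hfv] at h
    rw [← hA v w hvw, show (Matrix.vecMulVec a a + Matrix.vecMulVec b b + Matrix.vecMulVec c c) v w
      = ![a v, b v, c v] ⬝ᵥ ![a w, b w, c w] by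
        simp [Matrix.vecMulVec_apply, dotProduct, Fin.sum_univ_three], h]
    simp
  · rintro ⟨f, hf, h⟩
    refine ⟨Matrix.of (fun v => binaryVec (f v)) * (Matrix.of fun v => binaryVec (f v)).transpose,
      ⟨?_, fun v w hvw => ?_⟩, ?_⟩
    · simp [Matrix.IsSymm, Matrix.transpose_mul]
    · rw [h v w hvw, Matrix.mul_apply']
      change binaryVec (f v) ⬝ᵥ binaryVec (f w) ≠ 0 ↔ _
      rw [binaryVec_dotProduct (hf v) (hf w)]
      simp
    · refine (Matrix.rank_mul_le_left _ _).trans ?_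
      simpa using Matrix.rank_le_card_width (Matrix.of fun v => binaryVec (f v))

/-! ### Induced copies of graphs coded by bit masks -/

/-- The edge list `E` as a set of binary digits. -/
def edgeMask (E : List ℕ) : ℕ := E.foldr (fun e M => 1 <<< e ||| M) 0

theorem testBit_edgeMask (E : List ℕ) (i : ℕ) : (edgeMask E).testBit i = true ↔ i ∈ E := by
  induction E with
  | nil => simp [edgeMask]
  | cons e E ih =>
    rw [show edgeMask (e :: E) = 1 <<< e ||| edgeMask E from rfl, Nat.testBit_or,
      Bool.or_eq_true, ih, List.mem_cons, Nat.one_shiftLeft, Nat.testBit_two_pow]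
    simp [eq_comm]

/-- The binary digits of a number, in a form that the kernel evaluates quickly. -/
def binaryDigit (M i : ℕ) : Bool := Nat.beq (Nat.land (Nat.shiftRight M i) 1) 1

theorem binaryDigit_eq (M i : ℕ) : binaryDigit M i = M.testBit i := by
  rw [Bool.eq_iff_iff, binaryDigit, Nat.beq_eq, Nat.testBit_eq_decide_div_mod_eq, decide_eq_true_eq]
  change (M >>> i) &&& 1 = 1 ↔ _
  rw [Nat.and_one_is_mod, Nat.shiftRight_eq_div_pow]

/-- The adjacency of the vertices labelled `i + 1 < j + 1` in a graph described by edge labels. -/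
def maskAdj (M i j : ℕ) : Bool := binaryDigit M (Nat.add (Nat.mul 10 i) (Nat.add j 11))

/-- `φ` embeds the graph on `0, ..., n - 1` with adjacency `adj` as an induced subgraph of `G`; only
the values `adj i j` with `i < j` matter. -/
def IsInducedCopy {V : Type*} (G : SimpleGraph V) (n : ℕ) (adj : ℕ → ℕ → Bool) (φ : ℕ → V) : Prop :=
  ∀ i j, i < j → j < n → φ i ≠ φ j ∧ (G.Adj (φ i) (φ j) ↔ adj i j = true)

/-- `G` contains the graph described by `d` as an induced subgraph. -/
def ContainsCopy {V : Type*} (G : SimpleGraph V) (d : ℕ × List ℕ) : Prop :=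
  ∃ φ, IsInducedCopy G d.1 (maskAdj (edgeMask d.2)) φ

/-- The adjacency of distinct vertices in any order. -/
def symmAdj (adj : ℕ → ℕ → Bool) (i j : ℕ) : Bool :=
  bif Nat.blt i j then adj i j else adj j i

theorem IsInducedCopy.symm {V : Type*} {G : SimpleGraph V} {n : ℕ} {adj : ℕ → ℕ → Bool} {φ : ℕ → V}
    (h : IsInducedCopy G n adj φ) {i j : ℕ} (hi : i < n) (hj : j < n) (hij : i ≠ j) :
    φ i ≠ φ j ∧ (G.Adj (φ i) (φ j) ↔ symmAdj adj i j = true) := by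
  obtain hlt | hlt := hij.lt_or_gt
  · simpa [symmAdj, Nat.blt_eq, hlt] using h i j hlt hj
  · have := h j i hlt hi
    rw [G.adj_comm] at this
    simpa [symmAdj, Nat.blt_eq, hlt.not_gt, Bool.cond_eq_ite, ne_comm] using this

/-- Checks that the adjacency of a vertex `x` to the vertices `q`, given by `adj`, is that of `i` to
`j, j + 1, ...` in the graph with edges `M`. -/
def isRowCopy (adj : ℕ → ℕ → Bool) (M x i : ℕ) : ℕ → List ℕ → Bool
  | _, [] => true
  | j, y :: q =>
    !Nat.beq x y && (bif symmAdj adj x y then maskAdj M i j else !maskAdj M i j) &&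
      isRowCopy adj M x i (j + 1) q

/-- Checks that the vertices `q` of a graph on `0, ..., h - 1` with adjacency `adj` induce, in this
order, the vertices `i, i + 1, ...` of the graph with edges `M`. -/
def isCopy (h : ℕ) (adj : ℕ → ℕ → Bool) (M : ℕ) : ℕ → List ℕ → Bool
  | _, [] => true
  | i, x :: q => Nat.blt x h && isRowCopy adj M x i (i + 1) q && isCopy h adj M (i + 1) q

theorem cond_not_eq_true {a b : Bool} : (bif a then b else !b) = true ↔ a = b := by
  cases a <;> cases b <;> simp

theorem isRowCopy_spec {adj : ℕ → ℕ → Bool} {M x i j : ℕ} {q : List ℕ}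
    (h : isRowCopy adj M x i j q = true) {k : ℕ} (hk : k < q.length) :
    x ≠ q.getD k 0 ∧ symmAdj adj x (q.getD k 0) = maskAdj M i (j + k) := by
  induction q generalizing j k with
  | nil => simp at hk
  | cons y q ih =>
    simp only [isRowCopy, Bool.and_eq_true, Bool.not_eq_true', cond_not_eq_true] at h
    cases k with
    | zero => exact ⟨fun hxy => by simp [hxy] at h, h.1.2⟩
    | succ k =>
      have := ih h.2 (k := k) (by simpa using hk)
      rwa [Nat.add_right_comm, Nat.add_assoc] at this

theorem lt_of_isCopy {h : ℕ} {adj : ℕ → ℕ → Bool} {M i : ℕ} {q : List ℕ}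
    (hq : isCopy h adj M i q = true) {a : ℕ} (ha : a < q.length) : q.getD a 0 < h := by
  induction q generalizing i a with
  | nil => simp at ha
  | cons x q ih =>
    simp only [isCopy, Bool.and_eq_true, Nat.blt_eq] at hq
    cases a with
    | zero => exact hq.1.1
    | succ a => exact ih hq.2 (by simpa using ha)

theorem isCopy_spec {h : ℕ} {adj : ℕ → ℕ → Bool} {M i : ℕ} {q : List ℕ}
    (hq : isCopy h adj M i q = true) {a b : ℕ} (hab : a < b) (hb : b < q.length) :
    q.getD a 0 ≠ q.getD b 0 ∧
      symmAdj adj (q.getD a 0) (q.getD b 0) = maskAdj M (i + a) (i + b) := by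
  induction q generalizing i a b with
  | nil => simp at hb
  | cons x q ih =>
    simp only [isCopy, Bool.and_eq_true] at hq
    obtain ⟨b, rfl⟩ := Nat.exists_eq_succ_of_ne_zero (by omega : b ≠ 0)
    cases a with
    | zero =>
      have := isRowCopy_spec hq.1.2 (k := b) (by simpa using hb)
      rwa [Nat.add_right_comm, Nat.add_assoc] at this
    | succ a =>
      have := ih hq.2 (a := a) (b := b) (by omega) (by simpa using hb)
      rwa [Nat.add_right_comm, Nat.add_assoc, Nat.add_right_comm i 1 b, Nat.add_assoc i b] at this

theorem IsInducedCopy.containsCopy {V : Type*} {G : SimpleGraph V} {h : ℕ} {adj : ℕ → ℕ → Bool}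
    {φ : ℕ → V} (hφ : IsInducedCopy G h adj φ) {d : ℕ × List ℕ} {q : List ℕ}
    (hl : q.length = d.1) (hq : isCopy h adj (edgeMask d.2) 0 q = true) : ContainsCopy G d := by
  refine ⟨fun i => φ (q.getD i 0), fun i j hij hj => ?_⟩
  rw [← hl] at hj
  obtain ⟨hne, hadj⟩ := isCopy_spec hq hij hj
  have := hφ.symm (lt_of_isCopy hq (hij.trans hj)) (lt_of_isCopy hq hj) hne
  rwa [hadj, Nat.zero_add, Nat.zero_add] at this

/-- The adjacency of a graph on `0, ..., n - 1` with edges `M` extended by the vertices `n` and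
`n + 1`, whose adjacencies to the smaller vertices are the binary digits of `m₁` and `m₂`. -/
def extendAdj (n M m₁ m₂ i j : ℕ) : Bool :=
  bif Nat.blt j n then maskAdj M i j
  else bif Nat.beq j n then binaryDigit m₁ i else binaryDigit m₂ i

/-- The map `φ` extended by the values `v` and `w` at `n` and `n + 1`. -/
def extendMap {V : Type*} (n : ℕ) (φ : ℕ → V) (v w : V) (i : ℕ) : V :=
  if i < n then φ i else if i = n then v else w

/-- The data `m₂` and `w` of the second new vertex stay arbitrary, so that `extend_two` can take
from here all pairs not involving that vertex. -/
theorem IsInducedCopy.extend_one {V : Type*} {G : SimpleGraph V} {n M m₁ m₂ : ℕ}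
    {φ : ℕ → V} {v w : V}
    (hφ : IsInducedCopy G n (maskAdj M) φ) (hv : ∀ i < n, φ i ≠ v)
    (hm : ∀ i < n, (G.Adj (φ i) v ↔ m₁.testBit i = true)) :
    IsInducedCopy G (n + 1) (extendAdj n M m₁ m₂) (extendMap n φ v w) := by
  intro i j hij hj
  obtain hj | rfl := Nat.lt_succ_iff_lt_or_eq.1 hj
  · simpa [extendMap, extendAdj, binaryDigit_eq, hj, hij.trans hj] using hφ i j hij hj
  · simpa [extendMap, extendAdj, binaryDigit_eq, hij] using ⟨hv i hij, hm i hij⟩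

theorem IsInducedCopy.extend_two {V : Type*} {G : SimpleGraph V} {n M m₁ m₂ : ℕ}
    {φ : ℕ → V} {v w : V}
    (hφ : IsInducedCopy G n (maskAdj M) φ) (hv : ∀ i < n, φ i ≠ v) (hw : ∀ i < n, φ i ≠ w)
    (hvw : v ≠ w) (hm₁ : ∀ i < n, (G.Adj (φ i) v ↔ m₁.testBit i = true))
    (hm₂ : ∀ i < n, (G.Adj (φ i) w ↔ m₂.testBit i = true))
    (hm : G.Adj v w ↔ m₂.testBit n = true) :
    IsInducedCopy G (n + 2) (extendAdj n M m₁ m₂) (extendMap n φ v w) := by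
  intro i j hij hj
  obtain hj | rfl := Nat.lt_succ_iff_lt_or_eq.1 hj
  · exact hφ.extend_one hv hm₁ i j hij hj
  · obtain hi | rfl := Nat.lt_succ_iff_lt_or_eq.1 hij
    · simpa [extendMap, extendAdj, binaryDigit_eq, hi, hij, Nat.beq_eq] using ⟨hw i hi, hm₂ i hi⟩
    · simpa [extendMap, extendAdj, binaryDigit_eq] using ⟨hvw, hm⟩

/-! ### Certificates for the extension of a representation -/

/-- The number whose binary digits are the products of the vectors `r` with `x`. -/
def dotCode (r : List ℕ) (x : ℕ) : ℕ := r.foldr (fun y c => 2 * c + (dot y x).toNat) 0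

theorem testBit_dotCode (r : List ℕ) (x : ℕ) {i : ℕ} (hi : i < r.length) :
    (dotCode r x).testBit i = dot (r.getD i 0) x := by
  induction r generalizing i with
  | nil => simp at hi
  | cons y r ih =>
    rw [show dotCode (y :: r) x = 2 * dotCode r x + (dot y x).toNat from rfl]
    cases i with
    | zero => cases h : dot y x <;> simp [h]
    | succ i =>
      rw [Nat.testBit_succ, show (2 * dotCode r x + (dot y x).toNat) / 2 = dotCode r x by
        cases dot y x <;> simp; omega]
      exact ih (by simpa using hi)

theorem dotCode_lt (r : List ℕ) (x : ℕ) : dotCode r x < 2 ^ r.length := by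
  induction r with
  | nil => simp [dotCode]
  | cons y r ih =>
    rw [show dotCode (y :: r) x = 2 * dotCode r x + (dot y x).toNat from rfl, List.length_cons,
      pow_succ]
    cases dot y x <;> simp <;> omega

/-- A copy of a target graph: the pair `(t, q)` stands for the `t`-th target, its vertices being
mapped to those whose labels are the decimal digits of `q`. -/
abbrev CopyCode := ℕ × ℕ

/-- A graph with a chosen representation, together with copies of other graphs in the extensions of
the graph by one or two vertices to which the representation does not extend. -/
structure SearchNode where
  /-- The number of vertices and the edges, in the format of `forbiddenList`. -/
  graph : ℕ × List ℕ
  /-- The vectors of `𝔽₂³` representing the vertices. -/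
  rep : List ℕ
  /-- The vectors allowed for further vertices. -/
  span : List ℕ
  /-- The copies in the extensions by one vertex. -/
  vertexCopies : List CopyCode
  /-- The copies in the extensions by two vertices. -/
  pairCopies : List CopyCode

/-- The decimal digits of `q`, most significant first, each diminished by one, followed by `l`. The
first argument bounds their number. -/
def vertexLabels : ℕ → ℕ → List ℕ → List ℕ
  | 0, _, l => l
  | k + 1, q, l => bif Nat.beq q 0 then l else
      vertexLabels k (Nat.div q 10) (Nat.pred (Nat.mod q 10) :: l)

/-- Checks that `c` is a copy of one of `targets` in a graph on `0, ..., h - 1`. -/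
def isTargetCopy (targets : List (ℕ × List ℕ)) (h : ℕ) (adj : ℕ → ℕ → Bool) (c : CopyCode) : Bool :=
  match targets[c.1]? with
  | none => false
  | some d => Nat.beq (vertexLabels d.1 c.2 []).length d.1 &&
    isCopy h adj (edgeMask d.2) 0 (vertexLabels d.1 c.2 [])

theorem IsInducedCopy.exists_containsCopy {V : Type*} {G : SimpleGraph V} {h : ℕ}
    {adj : ℕ → ℕ → Bool} {φ : ℕ → V} (hφ : IsInducedCopy G h adj φ) {targets : List (ℕ × List ℕ)}
    {c : CopyCode} (hc : isTargetCopy targets h adj c = true) :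
    ∃ d ∈ targets, ContainsCopy G d := by
  unfold isTargetCopy at hc
  cases hd : targets[c.1]? with
  | none => simp [hd] at hc
  | some d =>
    simp only [hd, Bool.and_eq_true, Nat.beq_eq] at hc
    exact ⟨d, List.mem_of_getElem? hd, hφ.containsCopy hc.1 hc.2⟩

/-- Checks `p` for the elements of two lists in corresponding positions. The second list may be
longer. -/
def zipAll {α β : Type*} (p : α → β → Bool) : List α → List β → Bool
  | [], _ => true
  | _ :: _, [] => false
  | a :: l, b :: m => p a b && zipAll p l m

theorem exists_of_zipAll {α β : Type*} {p : α → β → Bool} {l : List α} {m : List β}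
    (h : zipAll p l m = true) {a : α} (ha : a ∈ l) : ∃ b, p a b = true := by
  induction l generalizing m with
  | nil => simp at ha
  | cons x l ih =>
    cases m with
    | nil => simp [zipAll] at h
    | cons b m =>
      simp only [zipAll, Bool.and_eq_true] at h
      obtain rfl | ha := List.mem_cons.1 ha
      · exact ⟨b, h.1⟩
      · exact ih h.2 ha

namespace SearchNode

/-- The adjacencies of a further vertex that do not come from a vector in the span. -/
def badCodes (s : SearchNode) : List ℕ :=
  (List.range (2 ^ s.graph.1)).filter fun m => s.span.all fun x => !Nat.beq (dotCode s.rep x) m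

/-- The unordered pairs of vectors in the span. -/
def spanPairs (s : SearchNode) : List (ℕ × ℕ) :=
  s.span.flatMap fun x => (s.span.filter (Nat.ble x)).map (Prod.mk x)

/-- Checks that the vectors represent the graph. -/
def isRep (s : SearchNode) : Bool :=
  Nat.beq s.rep.length s.graph.1 && s.rep.all (Nat.blt · 8) && s.span.all (Nat.blt · 8) &&
    (List.range s.graph.1).all fun j => (List.range j).all fun i =>
      maskAdj (edgeMask s.graph.2) i j == dot (s.rep.getD i 0) (s.rep.getD j 0)

/-- Checks that every extension of the graph by one or two vertices to which the representation does
not extend contains one of `targets`. -/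
def isValid (s : SearchNode) (targets : List (ℕ × List ℕ)) : Bool :=
  s.isRep &&
  zipAll (fun m => isTargetCopy targets (s.graph.1 + 1)
      (extendAdj s.graph.1 (edgeMask s.graph.2) m 0)) s.badCodes s.vertexCopies &&
  -- The digit in position `s.graph.1` is the adjacency of the two new vertices. It is set to the
  -- opposite of their product, the only case in which the representation fails.
  zipAll (fun x => isTargetCopy targets (s.graph.1 + 2)
      (extendAdj s.graph.1 (edgeMask s.graph.2) (dotCode s.rep x.1)
        (dotCode s.rep x.2 + 2 ^ s.graph.1 * (!dot x.1 x.2).toNat))) s.spanPairs s.pairCopies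

end SearchNode

/-- Checks every node of a list, with the graphs of the later nodes and those of `final` as
targets. -/
def allValid (final : List (ℕ × List ℕ)) : List SearchNode → Bool
  | [] => true
  | s :: l => s.isValid (l.map SearchNode.graph ++ final) && allValid final l

theorem exists_testBit_iff (n : ℕ) (p : ℕ → Prop) :
    ∃ m < 2 ^ n, ∀ i < n, (p i ↔ m.testBit i = true) := by
  classical
  refine ⟨Nat.ofBits fun i : Fin n => decide (p i), Nat.ofBits_lt_two_pow _, fun i hi => ?_⟩
  rw [Nat.testBit_ofBits_lt _ _ hi, decide_eq_true_eq]

namespace SearchNode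

variable {s : SearchNode}

theorem isRep_spec (h : s.isRep = true) : s.rep.length = s.graph.1 ∧ (∀ x ∈ s.rep, x < 8) ∧
    (∀ x ∈ s.span, x < 8) ∧ ∀ i j, i < j → j < s.graph.1 →
      maskAdj (edgeMask s.graph.2) i j = dot (s.rep.getD i 0) (s.rep.getD j 0) := by
  simp only [isRep, Bool.and_eq_true, List.all_eq_true, Nat.blt_eq, Nat.beq_eq, List.mem_range,
    beq_iff_eq] at h
  exact ⟨h.1.1.1, h.1.1.2, h.1.2, fun i j hij hj => h.2 j hj i hij⟩

/-- Equal vectors are allowed, since distinct vertices may carry the same label. -/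
theorem mem_spanPairs {x y : ℕ} (hx : x ∈ s.span) (hy : y ∈ s.span) (hxy : x ≤ y) :
    (x, y) ∈ s.spanPairs := by
  simp [spanPairs, hx, hy, hxy, Nat.ble_eq]

/-- The code of a vector is below `2 ^ n`, so adding the digit in position `n` causes no carry. -/
theorem testBit_dotCode_add {n x y : ℕ} (hl : s.rep.length = n) :
    (∀ i < n, (dotCode s.rep y + 2 ^ n * (!dot x y).toNat).testBit i
      = dot (s.rep.getD i 0) y) ∧
    (dotCode s.rep y + 2 ^ n * (!dot x y).toNat).testBit n = !dot x y := by
  have hlt := hl ▸ dotCode_lt s.rep y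
  rw [Nat.add_comm]
  constructor
  · intro i hi
    rw [Nat.testBit_two_pow_mul_add _ hlt, if_pos hi, testBit_dotCode _ _ (hl ▸ hi)]
  · rw [Nat.testBit_two_pow_mul_add _ hlt, if_neg (lt_irrefl _), Nat.sub_self]
    cases dot x y <;> simp

/-- If no target occurs, the one-vertex certificates force every outside vertex to attach to the
copy like a vector of the span. After one such vector is chosen for each vertex, the two-vertex
certificates force the adjacencies among outside vertices. -/
theorem representable_or_contains {V : Type*} {G : SimpleGraph V} {targets : List (ℕ × List ℕ)}
    (h : s.isValid targets = true) (hs : ContainsCopy G s.graph) :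
    Representable G ∨ ∃ d ∈ targets, ContainsCopy G d := by
  classical
  by_contra! hcon
  obtain ⟨hG, hno⟩ := hcon
  obtain ⟨φ, hφ⟩ := hs
  simp only [isValid, Bool.and_eq_true] at h
  obtain ⟨⟨hrep, hvert⟩, hpair⟩ := h
  obtain ⟨hl, hr8, hs8, hr⟩ := isRep_spec hrep
  set n := s.graph.1 with hn
  have key : ∀ v, (∀ i < n, φ i ≠ v) →
      ∃ x ∈ s.span, ∀ i < n, (G.Adj (φ i) v ↔ dot (s.rep.getD i 0) x = true) := by
    intro v hv
    obtain ⟨m, hm, hbit⟩ := exists_testBit_iff n fun i => G.Adj (φ i) v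
    by_contra! hx
    obtain ⟨c, hc⟩ := exists_of_zipAll hvert (a := m) (by
      simp only [badCodes, List.mem_filter, List.mem_range, List.all_eq_true]
      refine ⟨hm, fun x hxs => ?_⟩
      rw [Bool.not_eq_true', Bool.eq_false_iff, ne_eq, Nat.beq_eq]
      rintro rfl
      obtain ⟨i, hi, hne⟩ := hx x hxs
      rw [hbit i hi, testBit_dotCode _ _ (hl ▸ hi)] at hne
      tauto)
    obtain ⟨d, hd, hd'⟩ := (hφ.extend_one (w := v) hv hbit).exists_containsCopy hc
    exact hno d hd hd'
  -- The certificates cover unordered pairs of vectors, hence the condition `x ≤ y`; the symmetry of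
  -- adjacency and of the product gives the other order.
  have pair : ∀ v w x y, v ≠ w → (∀ i < n, φ i ≠ v) → (∀ i < n, φ i ≠ w) → x ∈ s.span →
      y ∈ s.span → (∀ i < n, (G.Adj (φ i) v ↔ dot (s.rep.getD i 0) x = true)) →
      (∀ i < n, (G.Adj (φ i) w ↔ dot (s.rep.getD i 0) y = true)) → x ≤ y →
      (G.Adj v w ↔ dot x y = true) := by
    intro v w x y hvw hv hw hx hy hvx hwy hxy
    by_contra hne
    obtain ⟨c, hc⟩ := exists_of_zipAll hpair (mem_spanPairs hx hy hxy)
    obtain ⟨hb, hb'⟩ := testBit_dotCode_add (s := s) (x := x) (y := y) hl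
    obtain ⟨d, hd, hd'⟩ := (hφ.extend_two hv hw hvw
      (fun i hi => by rw [hvx i hi, testBit_dotCode _ _ (hl ▸ hi)])
      (fun i hi => by rw [hwy i hi, hb i hi])
      (by rw [hb', Bool.not_eq_true']; cases h : dot x y <;> simp_all)).exists_containsCopy hc
    exact hno d hd hd'
  choose g hg hgadj using key
  -- Vertices of the copy keep the vectors of the node, the others take the chosen ones. The index
  -- picked by `choose` is the expected one because `φ` is injective below `n`.
  let f : V → ℕ := fun v =>
    if h : ∃ i < n, φ i = v then s.rep.getD h.choose 0 else g v (by simpa using h)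
  have hf_in : ∀ i < n, f (φ i) = s.rep.getD i 0 := by
    intro i hi
    have hex : ∃ j < n, φ j = φ i := ⟨i, hi, rfl⟩
    have hj := hex.choose_spec
    have : hex.choose = i := by
      by_contra hne
      exact (hφ.symm hj.1 hi hne).1 hj.2
    simp only [f, dif_pos hex, this]
  have hf_out : ∀ v (hv : ∀ i < n, φ i ≠ v), f v = g v hv := fun v hv =>
    dif_neg (by simpa using hv)
  have hmix : ∀ i < n, ∀ v, (∀ i < n, φ i ≠ v) → (G.Adj (φ i) v ↔ dot (f (φ i)) (f v) = true) := by
    intro i hi v hv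
    rw [hf_in i hi, hf_out v hv, hgadj v hv i hi]
  refine hG ⟨f, fun v => ?_, fun v w hvw => ?_⟩
  · by_cases hv : ∃ i < n, φ i = v
    · obtain ⟨i, hi, rfl⟩ := hv
      rw [hf_in i hi, List.getD_eq_getElem _ _ (hl ▸ hi)]
      exact hr8 _ (List.getElem_mem _)
    · rw [hf_out v (by simpa using hv)]
      exact hs8 _ (hg _ _)
  · by_cases hv : ∃ i < n, φ i = v <;> by_cases hw : ∃ i < n, φ i = w
    · obtain ⟨i, hi, rfl⟩ := hv
      obtain ⟨j, hj, rfl⟩ := hw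
      rw [hf_in i hi, hf_in j hj]
      obtain hij | rfl | hij := lt_trichotomy i j
      · rw [(hφ i j hij hj).2, hr i j hij hj]
      · exact absurd rfl hvw
      · rw [G.adj_comm, (hφ j i hij hi).2, hr j i hij hi, dot_comm]
    · obtain ⟨i, hi, rfl⟩ := hv
      exact hmix i hi w (by simpa using hw)
    · obtain ⟨j, hj, rfl⟩ := hw
      rw [G.adj_comm, dot_comm]
      exact hmix j hj v (by simpa using hv)
    · have hv' : ∀ i < n, φ i ≠ v := by simpa using hv
      have hw' : ∀ i < n, φ i ≠ w := by simpa using hw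
      rw [hf_out v hv', hf_out w hw']
      obtain hxy | hxy := le_total (g v hv') (g w hw')
      · exact pair v w _ _ hvw hv' hw' (hg _ _) (hg _ _) (hgadj _ _) (hgadj _ _) hxy
      · rw [G.adj_comm, dot_comm]
        exact pair w v _ _ hvw.symm hw' hv' (hg _ _) (hg _ _) (hgadj _ _) (hgadj _ _) hxy

end SearchNode

/-- Targets of a node lie strictly after it, so replacing a node by a target it leads to must end in
`final`. -/
theorem representable_or_contains_of_allValid {V : Type*} {G : SimpleGraph V}
    {final : List (ℕ × List ℕ)} {l : List SearchNode} (hl : allValid final l = true)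
    (h : ∃ d ∈ l.map SearchNode.graph ++ final, ContainsCopy G d) :
    Representable G ∨ ∃ d ∈ final, ContainsCopy G d := by
  induction l with
  | nil => exact Or.inr (by simpa using h)
  | cons s l ih =>
    simp only [allValid, Bool.and_eq_true] at hl
    obtain ⟨d, hd, hG⟩ := h
    rw [List.map_cons, List.cons_append, List.mem_cons] at hd
    obtain rfl | hd := hd
    · exact (SearchNode.representable_or_contains hl.1 hG).elim Or.inl (ih hl.2)
    · exact ih hl.2 ⟨d, hd, hG⟩

theorem containsCopy_singleton {V : Type*} [Nonempty V] (G : SimpleGraph V) :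
    ContainsCopy G (1, []) :=
  ⟨fun _ => Classical.arbitrary V, fun i j hij hj => by simp at hj; omega⟩

/-! ### Deciding representability by backtracking -/

/-- The vectors not orthogonal to `x`, as a set of binary digits. -/
def nonOrthogonal (x : ℕ) : ℕ := dotCode [0, 1, 2, 3, 4, 5, 6, 7] x

theorem testBit_nonOrthogonal {x y : ℕ} (hy : y < 8) :
    (nonOrthogonal x).testBit y = dot x y := by
  rw [nonOrthogonal, testBit_dotCode _ _ hy, dot_comm]
  congr 1
  interval_cases y <;> rfl

/-- The sets of vectors `D` still allowed for the vertices `j, j + 1, ...` once the vertex `k` is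
represented by `x`. -/
def restrictDomains (adj : ℕ → ℕ → Bool) (k x : ℕ) : ℕ → List ℕ → List ℕ
  | _, [] => []
  | j, d :: D =>
    Nat.land d (bif adj k j then nonOrthogonal x else Nat.xor 255 (nonOrthogonal x)) ::
      restrictDomains adj k x (j + 1) D

theorem length_restrictDomains (adj : ℕ → ℕ → Bool) (k x j : ℕ) (D : List ℕ) :
    (restrictDomains adj k x j D).length = D.length := by
  induction D generalizing j with
  | nil => rfl
  | cons d D ih => simp [restrictDomains, ih]

theorem testBit_restrictDomains {adj : ℕ → ℕ → Bool} {k x j y i : ℕ} {D : List ℕ}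
    (hi : i < D.length) (hy : y < 8) :
    ((restrictDomains adj k x j D).getD i 0).testBit y = true ↔
      (D.getD i 0).testBit y = true ∧ adj k (j + i) = dot x y := by
  induction D generalizing i j with
  | nil => simp at hi
  | cons d D ih =>
    cases i with
    | zero =>
      change (d &&& (bif adj k j then nonOrthogonal x else 255 ^^^ nonOrthogonal x)).testBit y =
        true ↔
        d.testBit y = true ∧ adj k j = dot x y
      -- 255 has all eight digits equal to 1, so the exclusive or with it is the complement in 𝔽₂³.
      have h255 : (255 : ℕ).testBit y = true := by interval_cases y <;> rfl
      rw [Nat.testBit_and, Bool.and_eq_true, and_congr_right_iff]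
      intro _
      cases adj k j
      · rw [cond_false, Nat.testBit_xor, h255, testBit_nonOrthogonal hy, Bool.true_xor,
          Bool.not_eq_true', eq_comm]
      · rw [cond_true, testBit_nonOrthogonal hy, eq_comm]
    | succ i =>
      have := ih (i := i) (j := j + 1) (by simpa using hi)
      rwa [Nat.add_right_comm, Nat.add_assoc] at this

/-- Searches for a representation of the vertices `k, ..., k + n - 1` by vectors in the sets `D`. -/
def hasRep (adj : ℕ → ℕ → Bool) : ℕ → ℕ → List ℕ → Bool
  | n + 1, k, d :: D => [0, 1, 2, 3, 4, 5, 6, 7].any fun x =>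
      binaryDigit d x && (restrictDomains adj k x (k + 1) D).all (fun d => !Nat.beq d 0) &&
        hasRep adj n (k + 1) (restrictDomains adj k x (k + 1) D)
  | _, _, _ => true

/-- The sets `D` record the constraints imposed by the vertices already labelled. Rejecting a choice
that empties one of them is only pruning: soundness does not need that test, and a genuine
representation passes it because its own values stay in the restricted sets. -/
theorem hasRep_iff {adj : ℕ → ℕ → Bool} {n k : ℕ} {D : List ℕ} (hD : D.length = n) :
    hasRep adj n k D = true ↔ ∃ f : ℕ → ℕ,
      (∀ i < n, f (k + i) < 8 ∧ (D.getD i 0).testBit (f (k + i)) = true) ∧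
      ∀ i j, i < j → j < n → adj (k + i) (k + j) = dot (f (k + i)) (f (k + j)) := by
  induction n generalizing k D with
  | zero => simp [hasRep]
  | succ n ih =>
    obtain _ | ⟨d, D⟩ := D
    · simp at hD
    have hD' : D.length = n := by simpa using hD
    simp only [hasRep, List.any_eq_true, Bool.and_eq_true, binaryDigit_eq,
      fun x => ih (k := k + 1) ((length_restrictDomains adj k x (k + 1) D).trans hD')]
    constructor
    · rintro ⟨x, hx, ⟨hdx, -⟩, f, hf, hadj⟩
      have hx8 : x < 8 := by simp at hx; omega
      have hf' : ∀ i < n, (D.getD i 0).testBit (f (k + 1 + i)) = true ∧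
          adj k (k + 1 + i) = dot x (f (k + 1 + i)) := fun i hi =>
        (testBit_restrictDomains (hD' ▸ hi) (hf i hi).1).1 (hf i hi).2
      have hsucc : ∀ i, k + (i + 1) = k + 1 + i := fun i => by omega
      -- The labelling found for the later vertices is altered at `k`, where its value was
      -- irrelevant.
      obtain ⟨g, hg0, hg⟩ : ∃ g : ℕ → ℕ, g k = x ∧ ∀ i, g (k + (i + 1)) = f (k + 1 + i) :=
        ⟨fun i => if i = k then x else f i, if_pos rfl, fun i => by
          rw [hsucc]; exact if_neg (by omega)⟩
      refine ⟨g, fun i hi => ?_, fun i j hij hj => ?_⟩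
      · cases i with
        | zero => exact ⟨hg0.trans_lt hx8, (congrArg d.testBit hg0).trans hdx⟩
        | succ i =>
          rw [hg]
          exact ⟨(hf i (by omega)).1, (hf' i (by omega)).1⟩
      · obtain ⟨j, rfl⟩ := Nat.exists_eq_succ_of_ne_zero (by omega : j ≠ 0)
        rw [Nat.succ_eq_add_one, hg, hsucc]
        cases i with
        | zero =>
          rw [Nat.add_zero, hg0]
          exact (hf' j (by omega)).2
        | succ i =>
          rw [hg, hsucc]
          exact hadj i j (by omega) (by omega)
    · rintro ⟨f, hf, hadj⟩
      have hsucc : ∀ i, k + 1 + i = k + (i + 1) := fun i => by omega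
      have hr : ∀ i < n, ((restrictDomains adj k (f k) (k + 1) D).getD i 0).testBit
          (f (k + 1 + i)) = true := fun i hi => by
        rw [testBit_restrictDomains (hD' ▸ hi) (hsucc i ▸ (hf (i + 1) (by omega)).1), hsucc]
        exact ⟨(hf (i + 1) (by omega)).2, hadj 0 (i + 1) (by omega) (by omega)⟩
      refine ⟨f k, by have : f k < 8 := (hf 0 (by omega)).1; simp; omega, ⟨(hf 0 (by omega)).2, ?_⟩,
        f,
        fun i hi => ⟨hsucc i ▸ (hf (i + 1) (by omega)).1, hr i hi⟩, fun i j hij hj => ?_⟩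
      · rw [List.all_eq_true]
        intro e he
        obtain ⟨i, hi, rfl⟩ := List.mem_iff_getElem.1 he
        rw [length_restrictDomains, hD'] at hi
        rw [Bool.not_eq_true', Bool.eq_false_iff, ne_eq, Nat.beq_eq, ← List.getD_eq_getElem _ 0]
        intro h0
        have := hr i hi
        rw [h0, Nat.zero_testBit] at this
        exact Bool.false_ne_true this
      · rw [hsucc, hsucc]
        exact hadj _ _ (by omega) (by omega)

/-- Searches for a representation of the graph on `0, ..., n - 1`. -/
def isRepresentable (adj : ℕ → ℕ → Bool) (n : ℕ) : Bool := hasRep adj n 0 (List.replicate n 255)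

theorem isRepresentable_iff {adj : ℕ → ℕ → Bool} {n : ℕ} :
    isRepresentable adj n = true ↔ ∃ f : ℕ → ℕ, (∀ i < n, f i < 8) ∧
      ∀ i j, i < j → j < n → adj i j = dot (f i) (f j) := by
  rw [isRepresentable, hasRep_iff (List.length_replicate ..)]
  refine exists_congr fun f => ?_
  simp only [Nat.zero_add]
  refine and_congr_left fun _ => forall₂_congr fun i hi => ?_
  rw [List.getD_eq_getElem _ _ (by simpa using hi), List.getElem_replicate, and_iff_left_iff_imp]
  intro h
  generalize f i = y at h ⊢
  interval_cases y <;> rfl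

/-- The map from `0, 1, ...` onto the numbers other than `v`. -/
def skip (v i : ℕ) : ℕ := bif Nat.blt i v then i else Nat.succ i

/-- Checks that `d` describes a graph that is not representable while all its subgraphs with one
vertex less are, and that the edges are listed as required. -/
def isMinimalNonRepresentable (d : ℕ × List ℕ) : Bool :=
  Nat.ble d.1 8 && d.2.all (fun e => Nat.blt (e / 10) (e % 10)) &&
  !isRepresentable (maskAdj (edgeMask d.2)) d.1 && (List.range d.1).all fun v =>
    isRepresentable (fun i j => maskAdj (edgeMask d.2) (skip v i) (skip v j)) (d.1 - 1)

/-! ### The certificate for the 62 graphs -/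

set_option maxRecDepth 100000 in
/-- Every extension of one of these graphs by one or two vertices to which its representation does
not extend contains a later graph of the list or a graph of `forbiddenList`. -/
def searchNodes : List SearchNode := [
  -- The root. With only the zero vector available, the representation extends exactly to edgeless
  -- graphs; the obstruction is an edge, the graph of the next node.
  ⟨(1, []), [0], [0],
    [(0,12)],
    [(0,23)]⟩,
  ⟨(2, [12]), [1,1], [0,1],
    [(0,231), (0,132)],
    [(3,1324), (0,134), (0,341)]⟩,
  ⟨(3, [13,23]), [3,3,1], [0,1,2,3],
    [(5,2431), (5,1432), (3,2143), (3,1243)],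
    [(2,1435), (1,1235), (0,1245), (0,1253), (1,1234), (1,1234), (1,1234), (0,3451), (0,1253),
    (0,1243)]⟩,
  -- The span {0, 3, 5, 6} is the plane of vectors of even weight, on which the product is
  -- alternating; {0, 1, 2, 3} is a coordinate plane, on which it is not. Both kinds of form of rank
  -- 2 are needed.
  ⟨(4, [14,24,34]), [3,3,3,5], [0,3,5,6],
    [(4,2541), (4,1542), (4,3541), (4,1543), (4,2541), (4,1542), (2,2154), (2,1254), (0,1245),
    (2,1354), (2,2154), (2,1254)],
    [(1,1546), (4,1546), (4,4516), (0,1246), (2,1564), (4,5641), (0,1246), (0,1256), (0,1246),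
    (0,1245)]⟩,
  ⟨(4, [13,14,23,24,34]), [3,3,5,6], [0,3,5,6],
    [(3,2531), (3,1532), (1,5341), (1,5143), (1,2153), (1,1253), (1,5134), (3,2531), (3,1532),
    (1,2153), (1,1253), (2,12345)],
    [(0,1536), (3,1536), (3,3516), (1,5136), (1,1563), (3,5631), (1,5163), (1,3561), (1,5361),
    (1,4561)]⟩,
  ⟨(4, [13,24]), [1,2,1,2], [0,1,2,3],
    [(7,24351), (7,13452), (2,2351), (7,24153), (2,1235), (0,2135), (7,13254), (2,1254), (2,2351),
    (2,1435), (2,1254), (2,1235)],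
    [(20,125346), (0,5136), (0,5246), (0,2136), (7,24561), (2,1256), (0,2136), (7,13562), (0,2136),
    (0,2135)]⟩,
  ⟨(4, [14,23,24,34]), [1,2,2,3], [0,1,2,3],
    [(1,2541), (1,1542), (1,1352), (1,1543), (1,1253), (1,1542), (4,15234), (11,13524), (1,1352),
    (11,12534), (1,1253), (3,12345)],
    [(6,56124), (1,2546), (1,1546), (1,4516), (6,23561), (1,1256), (1,2561), (11,15624), (1,1562),
    (3,12356)]⟩,
  ⟨(5, [13,14,15,23,24,25,34,35,45]), [3,3,1,1,1], [0,1,2,3],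
    [(0,2631), (0,1632), (10,61243), (0,2641), (0,1642), (2,64513), (10,61234), (0,2631), (0,1632),
    (2,63514), (10,61253), (0,2651), (0,1652), (30,125634), (10,61235), (0,2631), (0,1632),
    (2,63415), (10,61243), (0,2641), (0,1642), (30,124635), (10,61234), (0,2631), (0,1632),
    (30,123645), (2,21634), (2,12634)],
    [(5,67123), (10,61237), (0,3617), (0,1637), (30,126734), (2,73416), (10,71263), (3,67341),
    (0,6713), (3,12673)]⟩,
  -- From here on the representing vectors generate 𝔽₂³ and the span is the whole space, so the
  -- adjacencies of a further vertex to the node determine its vector.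
  ⟨(4, [13,24,34]), [1,2,5,6], [0,1,2,3,4,5,6,7],
    [(38,24315), (38,13425), (7,21543), (15,24153), (7,12534), (15,13254), (0,21435), (0,12345)],
    [(4,56143), (5,24163), (5,13264), (24,12346), (19,12634), (3,21364), (3,12463), (7,32516),
    (5,24153), (5,24153), (5,24153), (5,24153), (5,24153), (5,24153), (5,24153), (5,13254),
    (5,13254), (5,13254), (5,13254), (5,13254), (5,13254), (24,12345), (24,12345), (24,12345),
    (24,12345), (24,12345), (19,12534), (19,12534), (19,12534), (19,12534), (3,21354), (3,21354),
    (3,21354), (3,12453), (3,12453), (3,32561)]⟩,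
  ⟨(5, [13,24,25,34,35,45]), [1,6,7,2,2], [0,1,2,3,4,5,6,7],
    [(37,24316), (37,13426), (6,21643), (14,24163), (6,12634), (2,21364), (4,13264), (14,13264),
    (18,12634), (4,25163), (2,12563), (23,12346), (6,12635), (37,24316), (37,13426), (14,13265),
    (6,21643), (4,24163), (2,12463), (14,24163), (2,21364), (4,13264), (18,12634), (23,12346)],
    [(3,67143), (4,24173), (6,12637), (14,13274), (2,12473), (6,32617), (6,12734), (6,21647),
    (4,24163), (4,24163), (4,24163), (4,24163), (4,24163), (4,24163), (4,24163), (2,12673),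
    (14,13274), (2,12473), (14,13276), (6,12734), (4,26173), (14,13264), (14,13264), (14,13264),
    (14,13264), (14,13264), (2,12463), (2,12463), (2,12463), (2,12463), (4,16452), (6,12734),
    (4,16452), (6,12634), (6,12634), (2,21674)]⟩,
  ⟨(5, [14,15,23,24,25,34,35,45]), [1,2,2,7,7], [0,1,2,3,4,5,6,7],
    [(17,16342), (13,16342), (17,16243), (13,16243), (0,16234), (3,61235), (7,13624), (22,13624),
    (7,12634), (22,12634), (22,16524), (35,156234), (0,16235), (3,61234), (17,16342), (13,16342),
    (17,16243), (13,16243), (22,16425), (35,146235), (7,13624), (22,13624), (7,12634), (22,12634)],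
    [(2,67124), (2,23167), (17,16247), (0,16237), (0,17234), (3,71234), (36,14276), (0,16237),
    (2,23671), (3,16237), (3,61237), (0,17234), (3,71234), (3,16237), (3,61237), (7,16724),
    (13,17642), (0,17234), (3,71234), (17,17642), (22,16724), (14,164523), (0,17234), (3,71234),
    (1,71462), (14,164523), (0,16234), (0,16234), (0,16234), (0,16234), (3,61234), (3,61234),
    (3,61234), (3,14672), (22,16427), (35,167234)]⟩,
  ⟨(5, [15,25,34,35,45]), [1,2,4,4,7], [0,1,2,3,4,5,6,7],
    [(4,62315), (4,61325), (4,61235), (0,26135), (0,16235), (4,41236), (4,61245), (4,62315),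
    (4,61325), (4,31246), (4,61235), (5,123456), (3,126345), (1,34126), (6,14635), (6,21365),
    (6,12365), (4,41236), (6,13645), (6,21465), (6,12465), (4,31246), (6,21365), (6,12365)],
    [(1,67125), (16,26157), (16,16257), (1,34127), (4,61275), (0,27135), (0,17235), (6,61257),
    (6,26715), (21,12675), (1,34127), (6,21765), (0,27135), (0,17235), (4,62317), (6,16725),
    (1,34127), (6,12765), (0,27135), (0,17235), (4,61327), (1,34126), (1,34126), (1,34126),
    (1,34126), (1,34126), (6,16735), (0,27135), (0,17235), (4,61237), (0,26135), (0,26135),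
    (0,26135), (0,16235), (0,16235), (5,123467)]⟩,
  ⟨(5, [15,23,24,35,45]), [1,2,6,6,5], [0,1,2,3,4,5,6,7],
    [(0,16342), (34,15326), (3,12653), (34,16324), (1,15263), (15,14362), (3,12654), (34,16423),
    (34,15326), (15,13462), (3,12653), (5,13426), (3,21635), (3,13462), (15,12653), (34,16324),
    (23,142365), (15,14362), (3,21635), (34,16423), (23,132465), (15,13462), (6,213456), (5,13465)],
    [(0,67135), (0,17342), (1,15273), (5,13427), (15,12753), (3,21637), (3,12657), (3,13472),
    (0,16342), (0,16342), (0,16342), (0,16342), (0,16342), (0,16342), (0,16342), (1,15263),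
    (5,13427), (1,15263), (1,15263), (1,15263), (3,13472), (5,13426), (5,13426), (5,13426),
    (5,13426), (5,13426), (15,12653), (15,12653), (15,12653), (3,13472), (18,125634), (34,16327),
    (3,13472), (23,132675), (3,13472), (3,13462)]⟩,
  ⟨(5, [12,35,45]), [1,1,2,4,6], [0,1,2,3,4,5,6,7],
    [(34,216354), (34,126354), (35,453612), (33,21635), (33,12635), (0,53126), (35,354612),
    (33,21645), (33,12645), (0,54126), (2,23416), (2,13426), (6,123465), (33,21653), (33,12653),
    (0,35126), (0,21356), (0,12356), (33,21653), (33,12653), (7,123456), (2,23416), (2,13426),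
    (4,13456)],
    [(12,136257), (26,356127), (14,46357), (0,45127), (14,36457), (0,35127), (6,123467), (0,53127),
    (7,356712), (0,37126), (0,45127), (0,47126), (0,35127), (0,37126), (0,53127), (4,46735),
    (0,63127), (19,34675), (0,35127), (10,47653), (0,53127), (0,45126), (0,45126), (0,35127),
    (0,73126), (0,53127), (4,36745), (0,35127), (10,37654), (0,53127), (0,35126), (0,35126),
    (0,35126), (7,123467), (0,53127), (0,53126)]⟩,
  ⟨(5, [12,25,34,35,45]), [1,3,4,4,6], [0,1,2,3,4,5,6,7],
    [(32,35216), (1,31652), (32,12536), (32,21634), (32,12634), (9,35162), (32,12546), (32,21643),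
    (32,12643), (9,45162), (32,12536), (9,35162), (1,13625), (7,341265), (1,14625), (32,21634),
    (32,12634), (18,13256), (1,13625), (32,21643), (32,12643), (18,14256), (9,12365), (8,123456)],
    [(11,136247), (13,56127), (13,13725), (1,31657), (32,12576), (18,13257), (1,13627), (1,23617),
    (3,56712), (13,13725), (9,57621), (9,57126), (18,13257), (3,51762), (13,57621), (13,13625),
    (13,13625), (13,13625), (13,13625), (13,13625), (13,13625), (25,342671), (32,21673), (18,13257),
    (32,37216), (13,23617), (1,16725), (18,13257), (32,12736), (32,21736), (18,13256), (18,13256),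
    (18,13256), (27,123456), (9,12376), (1,56721)]⟩,
  ⟨(6, [16,26,36,45,46,56]), [3,3,3,7,7,1], [0,1,2,3,4,5,6,7],
    [(0,72316), (0,71326), (0,73416), (0,71236), (0,72416), (0,71426), (0,71246), (0,72316),
    (0,71326), (0,51247), (0,71236), (0,72516), (0,71526), (0,51247), (0,71256), (0,72316),
    (0,71326), (0,41257), (0,71236), (0,72416), (0,71426), (0,41257), (0,72316), (0,71326),
    (1,124567), (0,71236), (20,217456), (20,127456), (67,1726453), (67,2716453), (2,31276),
    (67,3716452), (2,21376), (2,12376), (2,15746), (2,21476), (2,12476), (2,31276), (2,13476),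
    (2,21376), (2,12376), (0,51247), (2,14756), (2,21576), (2,12576), (2,31276), (2,13576),
    (2,21376), (2,12376), (0,41257), (2,21476), (2,12476), (2,31276), (2,13476), (2,21376),
    (2,12376)],
    [(4,781236), (2,71268), (1,124568), (0,71286), (0,81246), (2,41286), (31,46187), (0,71286),
    (1,124578), (1,124568), (2,81276), (0,81246), (2,41286), (2,41287), (0,81247), (1,124567),
    (1,124567), (0,81246), (2,41286), (4,451238), (0,81247), (67,4516782), (0,81246), (2,41286),
    (0,84716), (2,14786), (0,71246), (0,71246), (0,71246), (0,71246), (2,41276), (2,41276),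
    (2,41276), (4,451237), (0,41287), (2,17846)]⟩,
  ⟨(5, [14,25,35,45]), [7,3,3,4,5], [0,1,2,3,4,5,6,7],
    [(30,25416), (30,14526), (30,16253), (30,14536), (30,16352), (30,14526), (33,146523),
    (34,146253), (30,16253), (34,146352), (30,16352), (7,25164), (35,146523), (37,265341),
    (11,13265), (37,365241), (11,12365), (1,42365), (11,12645), (11,13645), (11,13265), (11,12645),
    (11,12365), (1,12356)],
    [(32,145267), (1,12357), (30,54176), (30,14576), (1,61547), (34,145276), (11,16547), (11,56147),
    (1,12356), (1,12356), (1,12356), (1,12356), (1,12356), (1,12356), (1,12356), (14,156723),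
    (30,16257), (7,25167), (1,12376), (25,165723), (30,52617), (37,675241), (11,12675), (34,147256),
    (11,16745), (30,17652), (1,26745), (30,16527), (16,17654), (30,25617), (19,152674), (19,162574),
    (30,17625), (10,1234567), (16,15764), (1,56714)]⟩,
  ⟨(6, [15,16,25,26,34,35,36,45,46]), [3,3,7,7,1,2], [0,1,2,3,4,5,6,7],
    [(36,345217), (36,345127), (13,375612), (10,17453), (6,17453), (10,17453), (6,17453), (10,17354),
    (6,17354), (10,17354), (6,17354), (18,217345), (18,127345), (19,1256734), (18,716345),
    (6,26751), (6,16752), (0,14735), (0,21375), (0,12375), (0,41275), (0,13745), (0,21475),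
    (0,12475), (0,31275), (6,16753), (0,21375), (0,12375), (18,715346), (6,25761), (6,15762),
    (10,17453), (0,21376), (0,12376), (0,41276), (10,17354), (0,21476), (0,12476), (0,31276),
    (6,15763), (0,21376), (0,12376), (73,1756342), (73,2756341), (0,31275), (0,14735), (0,21375),
    (0,12375), (0,41275), (0,13745), (0,21475), (0,12475), (0,31275), (0,21375), (0,12375),
    (28,156347)],
    [(2,781235), (0,71258), (0,71268), (36,345187), (29,15387), (0,31285), (0,31286), (10,17358),
    (0,67851), (15,56781), (0,81275), (0,81257), (0,31285), (0,31286), (0,81275), (0,57861),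
    (0,81276), (0,81267), (0,31285), (0,31286), (0,81276), (65,3415782), (34,837512), (0,31285),
    (0,31286), (0,13785), (32,152378), (0,31285), (0,31286), (10,17853), (0,31275), (0,31275),
    (0,31275), (0,31276), (0,31276), (0,17835)]⟩,
  ⟨(5, [15,24,25,34,35,45]), [7,3,3,5,1], [0,1,2,3,4,5,6,7],
    [(38,245316), (9,16452), (28,16243), (9,16453), (28,16342), (9,16452), (9,16254), (9,16354),
    (9,13264), (9,16254), (9,12364), (11,123564), (41,243516), (14,36425), (28,16243), (14,26435),
    (28,16342), (14,14625), (14,12645), (45,264531), (9,13264), (45,364521), (9,12364),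
    (10,123465)],
    [(1,671235), (41,243716), (5,17452), (9,16457), (5,17254), (9,16257), (28,15276), (9,26157),
    (11,123674), (5,17452), (9,17264), (5,17254), (9,17462), (14,17526), (14,27615), (5,16452),
    (5,16452), (5,16452), (5,16452), (5,16452), (5,16452), (45,674521), (5,17254), (14,67425),
    (9,17654), (28,17642), (5,16254), (5,16254), (5,16254), (5,16254), (10,123675), (9,17652),
    (28,17624), (16,162354), (5,26157), (29,243617)]⟩,
  ⟨(6, [13,14,25,26,35,36,45,46,56]), [3,7,5,5,4,4], [0,1,2,3,4,5,6,7],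
    [(27,25317), (27,13527), (31,254137), (27,25417), (27,27314), (8,24371), (31,253147), (27,25317),
    (27,27413), (8,23471), (22,251734), (11,123457), (8,17635), (27,26317), (27,13627), (4,13275),
    (8,12735), (27,26417), (27,27314), (8,24371), (8,12745), (27,26317), (27,27413), (8,23471),
    (8,12735), (13,16753), (11,123467), (13,12357), (8,17536), (27,25317), (27,13527), (4,13276),
    (8,12736), (27,25417), (27,27314), (8,24371), (8,12746), (27,25317), (27,27413), (8,23471),
    (8,12736), (13,15763), (11,123457), (4,25173), (32,134527), (4,13275), (8,12735), (16,241375),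
    (27,27314), (8,24371), (8,12745), (16,231475), (27,27413), (8,23471), (8,12735), (13,12357)],
    [(29,135278), (4,25183), (27,53187), (27,25387), (8,17538), (31,253187), (8,27358), (27,13587),
    (4,25173), (4,25173), (4,25173), (4,25173), (4,25173), (4,25173), (4,25173), (32,278134),
    (27,27138), (4,13278), (8,23871), (15,213458), (27,31728), (34,783152), (8,12738), (31,258137),
    (8,27853), (27,13782), (11,123478), (27,27318), (13,17853), (27,13728), (16,231785),
    (15,213458), (27,28713), (15,213457), (13,18357), (28,314728)]⟩,
  ⟨(6, [12,36,46,56]), [7,7,3,3,3,5], [0,1,2,3,4,5,6,7],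
    [(27,217364), (27,127364), (28,463712), (26,21736), (26,12736), (26,17364), (28,364712),
    (26,21746), (26,12746), (26,17463), (28,563712), (26,21736), (26,12736), (26,17365),
    (28,365712), (26,21756), (26,12756), (26,17563), (28,463712), (26,21736), (26,12736),
    (26,17364), (28,364712), (26,21746), (26,12746), (26,17463), (26,21736), (26,12736), (26,21763),
    (26,12763), (19,124376), (26,21764), (26,12764), (7,14376), (19,123476), (26,21763), (26,12763),
    (7,13476), (0,123467), (26,21765), (26,12765), (7,15376), (19,123576), (26,21763), (26,12763),
    (7,13576), (19,124376), (26,21764), (26,12764), (7,14376), (19,123476), (26,21763), (26,12763),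
    (7,13476), (36,367412), (36,367421)],
    [(5,137268), (39,364817), (33,128736), (28,368712), (33,128763), (28,638712), (0,123468),
    (19,367128), (9,134786), (12,16837), (7,18376), (12,13867), (7,18673), (0,123468), (1,368127),
    (21,631278), (26,17368), (3,36178), (7,16873), (0,123468), (26,63718), (19,123786), (7,13786),
    (28,763812), (0,123468), (26,18763), (21,361278), (26,17638), (0,123468), (26,36718),
    (0,123478), (0,123468), (26,18736), (0,123467), (0,123467), (0,367812)]⟩,
  ⟨(6, [12,35,36,45,46,56]), [7,7,3,3,5,6], [0,1,2,3,4,5,6,7],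
    [(26,217354), (26,127354), (27,453712), (25,21735), (25,12735), (25,17354), (27,354712),
    (25,21745), (25,12745), (25,17453), (18,127563), (25,21735), (25,12735), (10,152673),
    (18,127365), (25,21753), (25,12753), (10,132675), (11,47635), (25,21736), (25,12736), (6,14375),
    (11,37645), (25,21753), (25,12753), (6,13475), (25,21736), (25,12736), (18,127356), (25,21763),
    (25,12763), (10,132576), (11,47536), (25,21735), (25,12735), (25,17354), (11,37546), (25,21763),
    (25,12763), (25,17453), (25,21735), (25,12735), (25,21753), (25,12753), (18,124375), (25,21754),
    (25,12754), (6,14375), (18,123475), (25,21753), (25,12753), (6,13475), (19,1234567),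
    (35,357412), (35,357421), (7,134567)],
    [(4,137258), (0,126358), (0,125368), (27,358712), (0,123568), (27,538712), (18,127358),
    (18,357128), (0,126357), (11,15837), (6,18375), (11,13857), (6,18573), (6,16873), (25,63718),
    (0,125367), (25,17358), (2,35178), (6,15873), (6,18673), (25,53718), (18,123785), (6,13785),
    (11,78536), (11,78635), (25,18753), (0,123567), (25,17538), (25,17638), (25,35718), (18,125783),
    (11,78653), (25,18735), (18,126783), (25,18736), (26,354718)]⟩,
  ⟨(6, [12,16,26,34,35,45,46,56]), [1,1,6,2,2,7], [0,1,2,3,4,5,6,7],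
    [(5,47261), (5,47162), (24,34617), (24,16437), (24,21734), (24,12734), (5,17564), (24,21743),
    (24,12743), (24,35617), (24,16537), (24,21735), (24,12735), (1,16374), (5,17465), (24,21753),
    (24,12753), (24,34617), (24,16437), (24,21734), (24,12734), (1,16375), (24,21743), (24,12743),
    (19,341267), (9,132764), (1,47261), (1,47162), (31,126743), (34,216743), (34,126743),
    (24,21734), (24,12734), (1,34176), (5,13764), (24,21743), (24,12743), (10,15746), (12,135764),
    (24,21735), (24,12735), (10,13647), (5,13765), (24,21753), (24,12753), (10,14756), (12,134765),
    (24,21734), (24,12734), (1,34176), (5,13764), (24,21743), (24,12743), (10,24176), (10,14276),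
    (10,13647)],
    [(3,137248), (5,47168), (5,17468), (1,16384), (17,128453), (24,46187), (24,16487), (5,37648),
    (6,478126), (10,14786), (1,16384), (24,17834), (24,43817), (24,17843), (24,34817), (12,137864),
    (1,16384), (17,128453), (1,16387), (5,18764), (10,17846), (1,16374), (1,16374), (1,16374),
    (1,16374), (1,16374), (17,127453), (17,127453), (17,127453), (24,18437), (9,142573), (24,17348),
    (1,34178), (17,123784), (5,13784), (0,341267)]⟩,
  ⟨(6, [12,25,26,34,35,36,45,46,56]), [3,1,4,4,7,7], [0,1,2,3,4,5,6,7],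
    [(23,35217), (8,137425), (23,12537), (23,21734), (23,12734), (0,35172), (23,12547), (23,21743),
    (23,12743), (0,45172), (23,12537), (18,123457), (4,17625), (23,36217), (4,13725), (9,16752),
    (23,12637), (23,21734), (23,12734), (9,13257), (23,12647), (23,21743), (23,12743), (9,14257),
    (23,12637), (0,12375), (18,123467), (9,13257), (4,17526), (23,35217), (4,13726), (9,15762),
    (23,12537), (23,21734), (23,12734), (0,35172), (23,12547), (23,21743), (23,12743), (0,45172),
    (23,12537), (0,12376), (18,123457), (0,35172), (30,345721), (4,13725), (33,435721), (23,21734),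
    (23,12734), (9,13257), (33,345721), (23,21743), (23,12743), (9,14257), (0,12375), (9,13257)],
    [(2,137248), (4,37258), (25,218734), (23,35287), (23,12587), (0,35182), (23,52187), (4,17528),
    (11,317852), (11,312857), (4,38752), (9,18257), (0,35182), (9,58217), (9,18752), (10,3127856),
    (25,712834), (23,21783), (0,35182), (18,815627), (23,38217), (16,341782), (23,12783), (0,35182),
    (23,38127), (4,13728), (33,735821), (0,35182), (23,21837), (23,12837), (0,35172), (0,35172),
    (0,35172), (8,576821), (0,12378), (18,123478)]⟩,
  ⟨(5, [12,14,25,34,35,45]), [1,7,6,3,2], [0,1,2,3,4,5,6,7],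
    [(22,35216), (22,34126), (41,345126), (22,21436), (3,26453), (42,126453), (3,26354), (3,23614),
    (40,354126), (22,12536), (19,123564), (8,23146), (3,16345), (40,345216), (22,34126), (22,21436),
    (8,24635), (8,13256), (3,23614), (3,13625), (8,13654), (45,364512), (18,213546), (8,23146)],
    [(24,214367), (3,56127), (3,16527), (3,26357), (22,41276), (3,26417), (22,21476), (3,46217),
    (10,326741), (8,15672), (22,26437), (8,47126), (8,27641), (8,27146), (8,47621), (18,123456),
    (3,27463), (3,17543), (8,15734), (3,17625), (8,16752), (19,213465), (3,17543), (8,15734),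
    (3,17365), (8,13756), (3,16543), (3,16543), (22,62147), (3,46712), (8,15634), (3,27614),
    (8,24761), (29,674312), (8,16257), (32,621743)]⟩,
  ⟨(6, [12,13,14,25,26,34,35,36,45,46,56]), [1,3,7,7,2,2], [0,1,2,3,4,5,6,7],
    [(10,725341), (16,723415), (2,27413), (7,57413), (18,724153), (7,24731), (2,27314), (7,57314),
    (18,723154), (7,23741), (17,257134), (13,1725634), (2,17625), (10,726341), (2,17635), (7,16752),
    (2,27413), (7,67413), (7,17453), (7,24731), (2,27314), (7,67314), (7,17354), (7,23741),
    (2,17625), (7,16753), (4,167235), (7,16752), (2,17526), (10,725341), (2,17536), (7,15762),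
    (2,27413), (7,57413), (7,17463), (7,24731), (2,27314), (7,57314), (7,17364), (7,23741),
    (2,17526), (7,15763), (4,157236), (7,15762), (10,721345), (19,1237456), (2,27413), (4,247153),
    (7,17453), (7,24731), (2,27314), (4,237154), (7,17354), (7,23741), (17,217534), (20,215347)],
    [(14,782341), (2,57128), (2,17528), (28,341287), (21,21387), (2,37218), (21,31287), (2,27318),
    (20,278341), (7,15782), (38,347128), (7,28137), (7,38721), (7,38127), (7,28731), (4,178235),
    (10,827341), (2,18527), (7,15872), (2,18735), (7,17853), (13,2713456), (10,278341), (39,821357),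
    (28,341728), (38,348172), (10,712563), (21,73528), (21,73128), (2,27813), (44,781235),
    (2,38712), (7,23781), (6,374812), (7,17358), (3,278341)]⟩,
  ⟨(6, [14,25,36]), [1,2,4,1,2,4], [0,1,2,3,4,5,6,7],
    [(52,4172536), (52,5271436), (20,41725), (52,6371425), (20,41736), (20,52736), (20,41725),
    (52,1472536), (20,14725), (13,362147), (20,14736), (13,253147), (20,14725), (20,52736),
    (52,2571436), (20,25714), (22,271436), (20,25736), (20,25714), (13,143257), (20,41736),
    (20,14752), (22,175236), (22,147236), (20,14752), (20,25736), (20,14736), (27,147236),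
    (52,3671425), (20,36714), (20,36725), (20,41725), (22,371425), (22,372514), (20,41725),
    (20,14763), (22,176325), (20,14725), (20,36725), (22,147325), (20,14725), (27,147325),
    (20,25763), (20,25714), (22,276314), (20,36714), (22,257314), (20,25714), (27,257314),
    (20,14752), (20,25763), (20,14763), (27,147263), (20,14752), (27,147352), (27,257341)],
    [(78,14253678), (13,257148), (13,147258), (13,362148), (13,147368), (13,253148), (13,143258),
    (56,1438257), (52,7182536), (22,178236), (13,362148), (22,178325), (13,253148), (13,143258),
    (27,258317), (52,7281436), (13,362148), (22,278314), (13,253148), (13,143258), (27,148327),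
    (13,362147), (13,362147), (20,27183), (20,17283), (13,362147), (52,7381425), (13,253148),
    (13,143258), (27,148237), (13,253147), (20,17382), (13,253147), (13,143257), (13,143257),
    (64,1478253)]⟩,
  ⟨(7, [14,25,26,27,35,36,37,45,46,47,56,57,67]), [1,6,6,7,2,2,2], [0,1,2,3,4,5,6,7],
    [(19,25418), (19,14528), (19,18253), (19,14538), (19,18352), (19,14528), (22,148523),
    (23,148253), (19,18253), (23,148352), (19,18352), (37,148253), (0,18645), (19,26418),
    (19,14628), (0,13285), (19,14638), (0,12385), (19,14628), (5,48625), (0,12845), (5,16854),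
    (0,13845), (0,13285), (0,12845), (0,12385), (7,126845), (5,12458), (0,18546), (19,25418),
    (19,14528), (19,18253), (19,14538), (19,18352), (19,14528), (5,48526), (0,12846), (5,15864),
    (0,13846), (19,18253), (0,12846), (19,18352), (7,125846), (5,12468), (0,18745), (19,27418),
    (19,14728), (0,13285), (19,14738), (0,12385), (19,14728), (5,48725), (0,12845), (5,17854),
    (0,13845), (0,13285), (0,12845), (0,12385), (7,127845), (5,12458), (0,18547), (19,25418),
    (19,14528), (19,18253), (19,14538), (19,18352), (19,14528), (5,48527), (0,12847), (5,15874),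
    (0,13847), (19,18253), (0,12847), (19,18352), (8,182564), (5,12478), (0,18645), (19,26418),
    (19,14628), (0,13285), (19,14638), (0,12385), (19,14628), (5,48625), (0,12845), (5,16854),
    (0,13845), (0,13285), (0,12845), (0,12385), (7,126845), (5,12458), (0,18546), (19,25418),
    (19,14528), (19,18253), (19,14538), (19,18352), (19,14528), (5,48526), (0,12846), (5,15864),
    (0,13846), (19,18253), (0,12846), (19,18352), (7,125846), (5,12468), (24,148523), (26,285341),
    (0,13285), (26,385241), (0,12385), (29,285341), (0,12845), (0,13845), (0,13285), (0,12845),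
    (0,12385), (5,12458)],
    [(21,145289), (0,58149), (0,18549), (0,48259), (8,192564), (19,54198), (19,14598), (0,28459),
    (20,253819), (5,15894), (1,123569), (19,18925), (19,52918), (19,18952), (19,25918), (7,128945),
    (5,49825), (8,192564), (5,49528), (0,19845), (5,18954), (1,123568), (1,123568), (0,49852),
    (0,19285), (5,12958), (8,182564), (14,195623), (8,182564), (19,19528), (14,185623), (19,18259),
    (5,58419), (26,895241), (0,12895), (24,189523)]⟩,
  ⟨(5, [14,25,34,35,45]), [1,2,4,5,6], [0,1,2,3,4,5,6,7],
    [(18,25416), (18,14526), (18,26143), (24,143562), (18,16352), (18,14362), (26,253416),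
    (27,265431), (18,16253), (29,253461), (18,16352), (4,15634), (26,143526), (27,164532),
    (18,26143), (29,143562), (18,14362), (4,24635), (30,134562), (4,13654), (4,23645), (34,146352),
    (34,256341), (4,12456)],
    [(20,145267), (18,25476), (18,14576), (4,12457), (24,145726), (26,253716), (26,143726),
    (18,54176), (19,253617), (18,16753), (4,12457), (18,16752), (18,25716), (18,16725), (18,52716),
    (19,143627), (4,12457), (18,14762), (18,26714), (18,14726), (18,41726), (4,12456), (4,12456),
    (18,26173), (18,16273), (4,12456), (30,164572), (29,173562), (29,273461), (18,27146),
    (34,167352), (18,16372), (4,15736), (34,267341), (4,24736), (2,246713)]⟩,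
  ⟨(6, [16,24,25,26,34,35,36,45,46,56]), [1,6,6,2,2,3], [0,1,2,3,4,5,6,7],
    [(27,246317), (28,724631), (17,17243), (28,734621), (17,17342), (12,174523), (29,126437),
    (27,254371), (3,37524), (17,17253), (3,27534), (17,17352), (5,172364), (5,152374), (29,126537),
    (27,245371), (3,37425), (17,17243), (3,27435), (17,17342), (5,172365), (5,142375), (29,126437),
    (3,37624), (3,37624), (3,27634), (3,27634), (5,172364), (30,243617), (3,37426), (17,17243),
    (3,27436), (17,17342), (34,452671), (30,253617), (3,12746), (3,37524), (17,17253), (3,27534),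
    (17,17352), (8,235746), (3,15726), (30,243617), (3,12756), (3,37425), (17,17243), (3,27435),
    (17,17342), (8,234756), (3,14726), (3,12746), (34,274631), (3,13746), (34,374621), (3,12746),
    (71,2456731)],
    [(10,781246), (18,187243), (29,126837), (0,123684), (17,16287), (3,14826), (28,784621),
    (17,26187), (18,243718), (3,12786), (0,123684), (17,17824), (3,14826), (17,17842), (17,24817),
    (8,237845), (0,123684), (5,182367), (3,14826), (30,273618), (27,274381), (0,123674), (3,68472),
    (3,14826), (3,78264), (3,12847), (25,164278), (3,14826), (22,723618), (17,18427), (3,14726),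
    (3,14726), (3,14726), (34,784621), (3,28674), (22,178423)]⟩,
  ⟨(6, [14,15,24,25,26,34,35,36,46,56]), [1,6,6,3,3,2], [0,1,2,3,4,5,6,7],
    [(26,264317), (27,726431), (16,17263), (27,736421), (16,17362), (13,176234), (29,263417),
    (34,714253), (2,37624), (16,17263), (2,27634), (16,17362), (2,57642), (2,16724), (29,263517),
    (34,715243), (2,37625), (16,17263), (2,27635), (16,17362), (2,47652), (2,16725), (29,263417),
    (2,37624), (16,17263), (2,27634), (16,17362), (64,2674531), (28,124637), (2,37426), (2,37426),
    (2,27436), (2,27436), (0,174523), (2,57246), (2,12764), (2,37526), (2,13764), (2,27536),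
    (2,12764), (13,157234), (15,523476), (2,47256), (2,12765), (2,37426), (2,13765), (2,27436),
    (2,12765), (13,147235), (15,423576), (2,12764), (33,276431), (2,13764), (33,376421), (2,12764),
    (15,145267)],
    [(9,781264), (24,781423), (28,124837), (29,263817), (16,14287), (2,16824), (27,786421),
    (16,24187), (29,718423), (2,12784), (34,714283), (16,17826), (2,16824), (16,17862), (16,26817),
    (7,234567), (13,187234), (0,184523), (2,16824), (29,273418), (26,274318), (15,423786),
    (2,48672), (2,16824), (2,78246), (2,12867), (0,174523), (2,16824), (0,174523), (16,72418),
    (2,16724), (2,16724), (2,16724), (33,786421), (2,28476), (19,243178)]⟩,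
  ⟨(6, [13,14,25,26,35,36,45,46]), [1,2,5,5,6,6], [0,1,2,3,4,5,6,7],
    [(15,25317), (15,13527), (19,254137), (15,25417), (15,27314), (33,173526), (19,253147),
    (15,25317), (15,27413), (33,174526), (20,256317), (12,251347), (20,134527), (15,26317),
    (15,13627), (33,275314), (24,143572), (15,26417), (15,27314), (1,12357), (24,134572),
    (15,26317), (15,27413), (1,12457), (24,265371), (15,17526), (4,162573), (1,12357), (20,134627),
    (15,25317), (15,13527), (33,276314), (19,254137), (15,25417), (15,27314), (1,12367),
    (19,253147), (15,25317), (15,27413), (1,12467), (24,256371), (15,17625), (4,152673), (1,12367),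
    (20,134527), (33,275314), (24,143572), (4,241375), (15,27314), (1,12357), (24,134572),
    (4,231475), (15,27413), (1,12457), (3,213457), (3,125637)],
    [(17,135278), (15,25387), (15,13587), (1,12358), (21,135827), (19,253187), (20,134827),
    (15,53187), (10,251734), (10,251734), (1,12358), (15,17852), (15,25817), (15,17825), (15,52817),
    (16,314728), (1,12358), (15,13872), (15,27813), (15,13827), (15,31827), (1,12357), (1,12357),
    (1,12357), (1,12357), (1,12357), (27,173582), (24,183572), (24,285371), (15,28137), (4,231785),
    (15,28317), (23,287134), (4,152783), (33,287314), (20,278134)]⟩,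
  ⟨(6, [13,15,24,26,35,46,56]), [1,2,1,2,5,6], [0,1,2,3,4,5,6,7],
    [(14,26517), (14,15627), (14,31724), (14,26537), (14,26517), (14,13724), (14,42715), (14,15647),
    (14,24713), (14,15627), (14,31726), (14,13742), (14,24715), (14,13726), (7,247135), (24,315762),
    (14,15724), (14,31724), (24,135762), (14,13724), (37,135762), (14,15742), (14,24713),
    (14,31726), (14,13742), (33,157642), (14,13726), (37,135762), (7,137246), (14,26713),
    (24,426751), (14,31724), (14,13762), (14,13724), (14,42715), (24,246751), (14,24713),
    (33,267513), (14,13742), (14,24715), (33,135762), (37,246751), (14,26713), (14,15724),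
    (14,31724), (14,13762), (52,1357624), (14,13724), (0,12567), (14,15742), (14,24713),
    (52,2467513), (0,12567), (14,13742), (0,14567), (0,16375)],
    [(16,156278), (14,26587), (14,15687), (0,12568), (7,248135), (7,247138), (7,137248), (14,65187),
    (24,715862), (33,157682), (0,12568), (14,17862), (14,26817), (14,17826), (14,62817),
    (24,726851), (0,12568), (14,15872), (14,27815), (14,15827), (14,51827), (0,12567), (0,12567),
    (0,12567), (0,12567), (0,12567), (7,247135), (7,247135), (7,247135), (14,28157), (9,261357),
    (14,28517), (9,261357), (7,136782), (9,152467), (9,621378)]⟩,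
  ⟨(5, [13,15,24,25,34,35,45]), [1,2,5,6,3], [0,1,2,3,4,5,6,7],
    [(13,24316), (13,13426), (27,245316), (35,245316), (34,153426), (38,163524), (27,135426),
    (34,254316), (35,135426), (38,264513), (39,163542), (39,264531), (28,135426), (13,24316),
    (13,13426), (40,135642), (37,245316), (42,136542), (37,135426), (42,246531), (41,135642),
    (43,136542), (43,246531), (44,135642)],
    [(15,134267), (13,24376), (13,13476), (28,137426), (13,15476), (17,243176), (17,134276),
    (13,43176), (23,613742), (32,136472), (35,247316), (13,16742), (13,24716), (13,16724),
    (13,42716), (23,624731), (35,137426), (13,13762), (13,26713), (13,13726), (13,31726),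
    (44,136742), (41,136742), (34,264317), (34,163427), (40,136742), (25,163472), (22,173462),
    (22,274361), (13,27136), (2,231674), (13,27316), (34,315672), (2,142673), (38,276513),
    (31,351627)]⟩,
  ⟨(7, [16,17,23,24,25,36,37,46,47,56,57,67]), [7,3,5,5,5,4,4], [0,1,2,3,4,5,6,7],
    [(12,23618), (12,16328), (16,164238), (12,18324), (12,16428), (20,183245), (16,163248),
    (12,18423), (12,16328), (20,184235), (16,165238), (12,18325), (12,16528), (24,138245),
    (16,163258), (12,18523), (12,16328), (20,185234), (16,164238), (12,18324), (12,16428),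
    (24,138254), (16,163248), (12,18423), (12,16328), (24,148253), (1,281673), (7,162834),
    (17,234618), (12,23718), (12,17328), (30,186324), (21,243681), (12,18324), (12,17428),
    (20,183245), (21,234681), (12,18423), (12,17328), (20,184235), (21,253681), (12,18325),
    (12,17528), (24,138245), (17,234618), (12,18523), (12,17328), (20,185234), (21,243681),
    (12,18324), (12,17428), (24,138254), (21,234681), (12,18423), (12,17328), (24,148253),
    (26,176382), (0,217836), (0,123468), (9,172348), (17,234718), (12,23618), (12,16328),
    (30,187324), (16,164238), (12,18324), (12,16428), (20,183245), (16,163248), (12,18423),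
    (12,16328), (20,184235), (16,165238), (12,18325), (12,16528), (24,138245), (17,234718),
    (12,18523), (12,16328), (20,185234), (16,164238), (12,18324), (12,16428), (24,138254),
    (16,163248), (12,18423), (12,16328), (24,148253), (26,167382), (0,216837), (7,162834),
    (9,162348), (17,234618), (30,186324), (21,243681), (12,18324), (1,142386), (20,183245),
    (21,234681), (12,18423), (1,132486), (20,184235), (21,253681), (12,18325), (0,123468),
    (24,138245), (17,234618), (12,18523), (1,132586), (20,185234), (21,243681), (12,18324),
    (1,142386), (24,138254), (21,234681), (12,18423), (1,132486), (24,148253), (28,167832),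
    (42,167832)],
    [(14,163289), (9,162349), (12,36198), (12,16398), (17,234918), (16,163298), (0,123469),
    (12,23698), (9,162348), (9,162348), (9,162348), (9,162348), (9,162348), (9,162348), (9,162348),
    (17,189234), (12,18239), (30,189324), (20,189234), (0,123469), (12,32819), (19,893261),
    (26,169382), (16,169238), (0,123469), (12,19832), (0,218936), (12,18329), (0,123469),
    (12,23819), (1,132896), (0,123469), (12,19823), (0,123468), (0,123468), (13,324819)]⟩,
  ⟨(6, [15,23,24,26,35,36,45,46,56]), [7,3,5,5,4,6], [0,1,2,3,4,5,6,7],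
    [(11,23517), (11,15327), (21,362471), (15,154237), (11,17324), (11,15427), (11,17364),
    (15,153247), (11,17423), (11,15327), (11,17463), (22,156327), (11,26517), (11,15627),
    (16,234517), (0,172365), (29,175324), (20,243571), (11,17324), (0,142375), (11,17364),
    (20,234571), (11,17423), (0,132475), (11,17463), (25,263571), (6,172634), (37,263751),
    (22,153627), (11,23517), (11,15327), (15,154237), (11,17324), (11,15427), (27,426371),
    (15,153247), (11,17423), (11,15327), (27,326471), (58,2364571), (6,152734), (8,152347),
    (16,234517), (21,326471), (29,175324), (20,243571), (11,17324), (0,142375), (32,175324),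
    (20,234571), (11,17423), (0,132475), (32,175423), (27,236751), (2,253467), (41,236751)],
    [(13,153278), (11,65187), (11,35187), (11,15387), (16,234817), (15,153287), (22,153827),
    (11,23587), (8,152347), (8,152347), (11,17268), (8,152347), (11,17368), (8,152347), (11,62718),
    (16,178234), (11,17238), (29,178324), (19,178234), (11,17638), (11,32718), (18,783251),
    (25,158372), (15,158237), (22,158327), (11,18732), (10,178365), (11,17328), (11,17628),
    (11,23718), (0,132785), (0,172385), (11,18723), (0,162785), (11,18726), (12,324718)]⟩,
  ⟨(6, [16,23,26,34,35,45,46,56]), [1,2,6,4,4,7], [0,1,2,3,4,5,6,7],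
    [(10,32617), (14,164327), (10,17234), (10,16237), (17,453271), (10,16437), (14,162347),
    (10,17432), (14,165327), (10,17235), (10,16237), (21,174352), (10,16537), (24,543721),
    (14,162357), (10,17532), (14,164327), (10,17234), (10,16237), (21,175342), (10,16437),
    (24,453721), (14,162347), (10,17432), (55,3452671), (10,16237), (5,163724), (27,453721),
    (15,324617), (19,342671), (10,17234), (47,4536271), (17,453271), (31,176234), (19,324671),
    (10,17432), (19,352671), (10,17235), (23,547612), (21,174352), (25,276451), (24,543721),
    (15,324617), (10,17532), (19,342671), (10,17234), (23,457612), (21,175342), (25,276541),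
    (24,453721), (19,324671), (10,17432), (27,457621), (31,176432), (27,457621), (27,453721)],
    [(12,162378), (10,32687), (21,162837), (10,46187), (14,162387), (10,26187), (10,16287),
    (15,324817), (3,172453), (10,17834), (10,43817), (10,17832), (10,23817), (10,17823), (10,32817),
    (23,728614), (21,182374), (25,276841), (24,273841), (21,167238), (10,18437), (26,178234),
    (24,483721), (10,27184), (10,17284), (31,178234), (23,748612), (21,184372), (14,167328),
    (10,18237), (26,178432), (10,17328), (31,178432), (17,782361), (24,168273), (9,178456)]⟩,
  ⟨(7, [13,14,15,23,24,25,36,37,46,47,56,57,67]), [3,3,5,5,5,4,4], [0,1,2,3,4,5,6,7],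
    [(16,673218), (16,673128), (46,6743128), (27,831425), (27,832415), (6,648123), (46,6734128),
    (27,841325), (27,842315), (6,638124), (46,6753128), (6,528341), (6,518342), (6,658123),
    (46,6735128), (27,851324), (27,852314), (6,638125), (46,6743128), (6,428351), (6,418352),
    (6,648123), (46,6734128), (6,328451), (6,318452), (6,638124), (53,1834672), (53,2834671),
    (17,867312), (18,816372), (18,826371), (27,763182), (27,863142), (27,831425), (27,832415),
    (6,748123), (27,864132), (27,841325), (27,842315), (6,738124), (27,863152), (6,528341),
    (6,518342), (6,758123), (27,865132), (27,851324), (27,852314), (6,738125), (27,863142),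
    (6,428351), (6,418352), (6,748123), (27,864132), (6,328451), (6,318452), (6,738124),
    (22,768312), (24,183672), (24,283671), (33,763812), (17,876312), (18,817362), (18,827361),
    (27,673182), (27,873142), (27,831425), (27,832415), (6,648123), (27,874132), (27,841325),
    (27,842315), (6,638124), (27,873152), (6,528341), (6,518342), (6,658123), (27,875132),
    (27,851324), (27,852314), (6,638125), (27,873142), (6,428351), (6,418352), (6,648123),
    (27,874132), (6,328451), (6,318452), (6,638124), (22,678312), (24,183762), (24,283761),
    (33,673812), (54,8671342), (54,8672341), (27,863142), (27,831425), (27,832415), (1,1246738),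
    (27,864132), (27,841325), (27,842315), (1,1236748), (27,863152), (6,528341), (6,518342),
    (8,134678), (27,865132), (27,851324), (27,852314), (1,1236758), (27,863142), (6,428351),
    (6,418352), (8,135678), (27,864132), (6,328451), (6,318452), (8,145678), (26,678312),
    (26,678321)],
    [(2,891673), (21,613928), (9,63198), (16,673198), (17,896312), (46,6739128), (8,134679),
    (9,13698), (57,1893426), (4,916734), (22,182369), (33,693812), (6,698123), (0,123489),
    (19,183269), (4,816734), (14,812369), (27,693182), (6,638129), (4,816734), (9,81369),
    (45,6713892), (22,698312), (46,6793128), (8,134679), (14,968312), (22,869312), (27,863192),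
    (33,863912), (17,968312), (1,1236789), (8,134679), (27,968132), (0,123489), (33,968312),
    (12,132689)]⟩,
  ⟨(6, [13,14,15,16,23,24,25,26,35,36,45,46,56]), [3,3,5,5,1,1], [0,1,2,3,4,5,6,7],
    [(49,2356417), (49,1356427), (49,4156237), (34,245317), (34,145327), (7,712563), (49,3156247),
    (34,235417), (34,135427), (7,712564), (38,256317), (38,156327), (50,1365427), (38,236517),
    (38,136527), (7,712365), (38,416537), (37,713542), (37,723541), (7,412375), (38,316547),
    (37,714532), (37,724531), (7,312475), (7,734165), (7,234175), (7,134275), (64,1365742),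
    (50,1356427), (38,235617), (38,135627), (7,712356), (38,415637), (34,245317), (34,145327),
    (7,412376), (38,315647), (34,235417), (34,135427), (7,312476), (7,734156), (7,234176),
    (7,134276), (64,1356742), (39,235617), (39,135627), (39,415637), (37,713542), (37,723541),
    (7,412375), (39,315647), (37,714532), (37,724531), (7,312475), (7,234175), (7,134275)],
    [(2,7812356), (50,1358427), (3,783512), (49,1356487), (18,153287), (49,3156287), (7,812563),
    (18,135287), (64,1375842), (7,812357), (7,834175), (7,834157), (7,812375), (7,812563),
    (50,1375428), (21,354178), (55,8354127), (5,875123), (7,712568), (7,812563), (20,731548),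
    (7,134785), (32,873512), (39,735618), (7,812563), (32,875312), (21,152378), (55,8152347),
    (7,812563), (20,713528), (7,312785), (7,812563), (32,875134), (7,712563), (7,712563),
    (21,132578)]⟩,
  ⟨(7, [13,16,17,23,26,27,34,35,45,46,47,56,57,67]), [3,3,1,7,7,2,2], [0,1,2,3,4,5,6,7],
    [(14,453218), (14,453128), (2,814536), (2,836712), (25,813264), (25,823164), (15,845312),
    (16,814352), (16,824351), (25,543182), (20,548312), (22,183452), (22,283451), (31,543812),
    (15,854312), (16,815342), (16,825341), (25,453182), (20,458312), (22,183542), (22,283541),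
    (31,453812), (52,8451362), (52,8452361), (67,45673812), (25,843162), (24,458312), (24,458321),
    (24,457618), (14,453218), (14,453128), (4,438126), (4,837126), (25,813274), (25,823174),
    (4,478123), (15,845312), (16,814352), (16,824351), (25,543182), (20,548312), (22,183452),
    (22,283451), (31,543812), (15,854312), (16,815342), (16,825341), (25,453182), (20,458312),
    (22,183542), (22,283541), (31,453812), (25,846132), (4,238146), (4,138246), (6,178456),
    (25,843172), (24,458312), (24,458321), (6,136458), (24,456718), (14,453218), (14,453128),
    (4,438127), (4,836127), (25,813264), (25,823164), (4,468123), (15,845312), (16,814352),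
    (16,824351), (25,543182), (20,548312), (22,183452), (22,283451), (31,543812), (15,854312),
    (16,815342), (16,825341), (25,453182), (20,458312), (22,183542), (22,283541), (31,453812),
    (25,847132), (4,238147), (4,138247), (6,168457), (25,843162), (24,458312), (24,458321),
    (6,137458), (44,4536128), (14,453218), (14,453128), (51,1836452), (51,2836451), (6,312678),
    (15,845312), (16,814352), (16,824351), (25,543182), (20,548312), (22,183452), (22,283451),
    (31,543812), (15,854312), (16,815342), (16,825341), (25,453182), (20,458312), (22,183542),
    (22,283541), (31,453812), (25,846132), (4,238146), (4,138246), (24,458312), (24,458321),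
    (6,312678)],
    [(0,891453), (2,896712), (24,456918), (14,453198), (7,13498), (7,46198), (7,43198), (15,894312),
    (6,189453), (6,812679), (4,968123), (31,948312), (4,469123), (4,439126), (31,943812),
    (6,189456), (4,938126), (25,948132), (4,469123), (4,439126), (25,943182), (43,4513892),
    (12,948312), (4,469123), (4,439126), (20,498312), (10,132489), (7,84619), (7,84319),
    (15,849312), (4,468123), (7,83469), (4,468123), (4,438126), (4,438126), (20,849312)]⟩,
  ⟨(6, [12,36,45,46,56]), [1,1,2,4,4,6], [0,1,2,3,4,5,6,7],
    [(7,217364), (7,127364), (8,463712), (6,21736), (6,12736), (6,17364), (8,364712), (6,21745),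
    (6,12745), (6,17463), (8,374512), (6,21736), (6,12736), (6,17365), (8,365712), (6,21754),
    (6,12754), (6,17563), (8,375412), (6,21736), (6,12736), (6,17364), (8,364712), (6,21746),
    (6,12746), (6,17463), (6,21736), (6,12736), (39,4563712), (6,21763), (6,12763), (13,456371),
    (6,21764), (6,12764), (40,5467312), (6,21763), (6,12763), (17,174653), (8,374512), (6,21745),
    (6,12745), (13,127345), (40,4567312), (6,21763), (6,12763), (17,175643), (8,375412), (6,21754),
    (6,12754), (13,127354), (6,21763), (6,12763), (41,4567312), (13,457312), (13,457321),
    (23,456731)],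
    [(38,3641278), (7,187364), (8,468712), (13,128764), (8,368712), (13,128763), (8,638712),
    (13,128736), (7,364718), (6,17864), (6,46817), (6,17863), (6,36817), (6,17836), (6,63817),
    (38,7381245), (8,183745), (8,378412), (13,128473), (8,483712), (6,18467), (22,178364),
    (13,127384), (6,37184), (6,17384), (23,127834), (40,7468312), (17,184673), (8,384712),
    (6,18367), (22,178463), (6,17483), (23,127843), (41,4578312), (23,457831), (1,631278)]⟩,
  ⟨(7, [12,35,36,37,45,46,47,56,57,67]), [1,1,6,6,2,2,2], [0,1,2,3,4,5,6,7],
    [(6,218354), (6,128354), (7,453812), (5,21835), (5,12835), (5,18354), (7,354812), (5,21845),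
    (5,12845), (5,18453), (5,21835), (5,12835), (39,3654812), (5,21853), (5,12853), (15,365481),
    (7,463812), (5,21836), (5,12836), (5,18364), (7,364812), (5,21853), (5,12853), (5,18463),
    (4,834675), (5,21836), (5,12836), (0,186734), (39,3564812), (5,21863), (5,12863), (15,356481),
    (7,453812), (5,21835), (5,12835), (5,18354), (7,354812), (5,21863), (5,12863), (5,18453),
    (4,834576), (5,21835), (5,12835), (0,185734), (39,3754812), (5,21853), (5,12853), (15,375481),
    (7,473812), (5,21837), (5,12837), (5,18374), (7,374812), (5,21853), (5,12853), (5,18473),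
    (64,37568412), (5,21837), (5,12837), (46,7356481), (39,3574812), (5,21873), (5,12873),
    (15,357481), (7,453812), (5,21835), (5,12835), (5,18354), (7,354812), (5,21873), (5,12873),
    (5,18453), (4,834567), (5,21835), (5,12835), (0,185634), (39,3654812), (5,21853), (5,12853),
    (15,365481), (7,463812), (5,21836), (5,12836), (5,18364), (7,364812), (5,21853), (5,12853),
    (5,18463), (64,36578412), (5,21836), (5,12836), (46,6357481), (39,3564812), (5,21863),
    (5,12863), (15,356481), (7,453812), (5,21835), (5,12835), (5,18354), (7,354812), (5,21863),
    (5,12863), (5,18453), (64,35678412), (5,21835), (5,12835), (46,5367481), (5,21853), (5,12853),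
    (40,3856412), (5,21854), (5,12854), (21,456381), (40,4856312), (5,21853), (5,12853),
    (21,356481), (15,358412), (15,358421)],
    [(37,3541289), (6,198354), (39,3594812), (18,354918), (7,539812), (12,129835), (7,359812),
    (12,129853), (6,354819), (15,359481), (15,359418), (5,18935), (5,53918), (5,18953), (5,35918),
    (64,38569412), (46,8356491), (4,934568), (0,195634), (39,3854912), (15,385491), (59,3568941),
    (22,563891), (0,195634), (17,138549), (29,198534), (38,5638912), (0,195634), (7,835912),
    (5,19538), (0,185634), (5,18359), (28,128935), (38,8953412), (13,198534), (0,351289)]⟩,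
  ⟨(6, [12,25,26,34,35,36,45,46]), [1,3,4,4,6,6], [0,1,2,3,4,5,6,7],
    [(4,35217), (9,356217), (4,12537), (4,21734), (4,12734), (23,127534), (4,12547), (4,21743),
    (4,12743), (23,127543), (4,12537), (22,172536), (11,345721), (4,36217), (13,365271), (4,17536),
    (4,12637), (4,21734), (4,12734), (4,17546), (4,12647), (4,21743), (4,12743), (4,17536),
    (4,12637), (27,345721), (43,6345721), (25,172536), (11,346721), (4,35217), (13,356271),
    (4,17635), (4,12537), (4,21734), (4,12734), (4,17645), (4,12547), (4,21743), (4,12743),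
    (4,17635), (4,12537), (27,346721), (43,5346721), (25,172635), (11,345721), (47,3456271),
    (14,435721), (4,21734), (4,12734), (26,127534), (14,345721), (4,21743), (4,12743), (26,127543),
    (27,345721), (3,256347)],
    [(6,125378), (4,35287), (6,128734), (6,218734), (4,12587), (19,128537), (11,348721), (4,52187),
    (14,712853), (4,17853), (4,35817), (23,127583), (26,358217), (4,17835), (4,53817), (16,172583),
    (6,721834), (4,12783), (32,128753), (13,385271), (4,38127), (49,1782563), (4,21783),
    (25,385217), (4,38217), (22,817526), (14,735821), (26,128537), (4,12837), (4,21837),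
    (35,127853), (25,172538), (31,127853), (43,5347821), (27,347821), (7,526178)]⟩,
  ⟨(6, [12,14,25,26,34,35,36,45,46,56]), [1,7,6,3,2,2], [0,1,2,3,4,5,6,7],
    [(3,35217), (3,34127), (22,345127), (3,21437), (26,563471), (23,127453), (12,215437), (3,35217),
    (21,354127), (3,12537), (0,123574), (28,127453), (12,124537), (3,36217), (3,34127), (22,346127),
    (3,21437), (0,213475), (24,752641), (28,217543), (12,216437), (3,36217), (24,354721),
    (29,127453), (3,12637), (28,625417), (0,123674), (32,345712), (12,124637), (3,35217), (3,34127),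
    (22,345127), (3,21437), (0,213476), (24,762541), (23,127453), (12,215437), (3,35217),
    (21,354127), (29,127463), (3,12537), (28,526417), (0,123574), (28,127453), (12,124537),
    (21,345217), (3,34127), (3,21437), (34,275634), (28,217543), (24,345712), (24,354721),
    (29,127453), (26,374512), (54,3475612), (32,345712)],
    [(5,214378), (3,35287), (12,124837), (0,213485), (3,41287), (3,52187), (3,21487), (3,34187),
    (13,712853), (29,127483), (3,27438), (3,17835), (3,53817), (3,17853), (3,35817), (0,123784),
    (0,213485), (24,872541), (28,527418), (12,217438), (22,347128), (0,213475), (0,213475),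
    (0,213475), (0,213475), (3,28734), (8,415278), (3,72548), (3,72148), (3,73418), (26,781425),
    (3,71258), (25,281743), (10,784312), (3,28743), (13,721843)]⟩,
  ⟨(6, [12,16,24,25,34,35,36,46,56]), [7,1,6,3,3,2], [0,1,2,3,4,5,6,7],
    [(2,34217), (2,36127), (21,346217), (2,12437), (14,146357), (20,172435), (6,125347), (2,35217),
    (2,36127), (2,17435), (2,12537), (23,536471), (20,742165), (23,172435), (6,124357), (2,34217),
    (2,36127), (2,17534), (2,12437), (23,436571), (20,752164), (23,172534), (11,126437),
    (20,364217), (2,36127), (2,21637), (48,3467521), (27,217463), (11,214637), (2,34217),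
    (7,345217), (2,12437), (20,716425), (20,172435), (6,125347), (2,35217), (11,354271), (2,17435),
    (2,12537), (30,176435), (19,473651), (23,172435), (6,124357), (2,34217), (11,345271), (2,17534),
    (2,12437), (30,176534), (19,573641), (23,172534), (23,364712), (23,346721), (28,127643),
    (25,374621), (1,245367), (31,346721)],
    [(4,124378), (2,36187), (11,214837), (6,124387), (2,42187), (2,61287), (2,12487), (2,34287),
    (12,721863), (28,127843), (2,17438), (2,27836), (2,71638), (2,27863), (2,34718), (1,178346),
    (14,147358), (20,817425), (27,617428), (11,127438), (21,347218), (19,783641), (7,817245),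
    (15,485217), (6,127348), (2,18734), (5,425178), (2,71648), (2,71248), (2,43718), (25,782416),
    (2,72168), (24,182743), (9,784321), (2,18743), (12,712843)]⟩,
  ⟨(7, [12,13,14,15,24,26,27,35,36,37,46,47,56,57,67]), [3,1,2,1,2,7,7], [0,1,2,3,4,5,6,7],
    [(40,3672418), (18,674218), (22,821463), (18,675318), (22,831562), (1,42835), (1,42835),
    (18,672418), (22,841263), (44,3516248), (1,24835), (1,24835), (18,675318), (26,563128),
    (18,673518), (22,851362), (1,35824), (1,35824), (44,2416358), (18,674218), (26,462138),
    (1,24853), (1,24853), (18,673518), (26,365128), (18,672418), (26,264138), (62,18243567),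
    (17,124768), (18,247638), (22,826413), (22,821473), (22,836512), (22,831572), (1,42835),
    (1,42835), (22,846213), (22,841273), (22,862731), (26,736218), (1,24835), (1,24835),
    (26,513628), (0,316248), (22,856312), (22,851372), (1,35824), (1,35824), (22,863721),
    (26,726318), (26,412638), (26,472138), (1,24853), (1,24853), (26,315628), (26,375128),
    (26,214638), (26,274138), (0,378246), (0,316248), (17,124678), (18,246738), (22,827413),
    (22,821463), (22,837512), (22,831562), (1,42835), (1,42835), (22,847213), (22,841263),
    (22,872631), (26,637218), (1,24835), (1,24835), (26,513728), (0,317248), (22,857312),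
    (22,851362), (1,35824), (1,35824), (22,873621), (26,627318), (26,412738), (26,462138),
    (1,24853), (1,24853), (26,315728), (26,365128), (26,214738), (26,264138), (0,368247),
    (0,317248), (45,2416358), (22,826413), (0,148672), (22,836512), (0,158673), (1,42835),
    (1,42835), (22,846213), (0,128674), (52,8246713), (1,24835), (1,24835), (26,513628), (0,316248),
    (22,856312), (0,138675), (1,35824), (1,35824), (52,8356712), (26,412638), (0,216358), (1,24853),
    (1,24853), (26,315628), (0,516248), (26,214638), (0,128674), (0,316248)],
    [(36,6724189), (18,672918), (18,673918), (8,672198), (1,12698), (1,63198), (1,62198),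
    (17,124698), (0,189672), (0,916248), (18,678219), (22,986213), (22,921863), (26,268139),
    (26,812639), (0,189673), (18,678319), (22,986312), (26,368129), (22,931862), (26,813629),
    (45,6723891), (46,1243689), (19,912638), (19,913628), (18,679281), (6,123689), (1,86319),
    (1,86219), (17,124968), (24,891236), (1,82639), (26,639218), (24,891326), (26,629318),
    (0,389246)]⟩,
  -- No node follows, so the target indices here refer to `forbiddenList` alone.
  ⟨(6, [12,13,16,24,25,26,34,35,36,45,46,56]), [3,5,5,4,4,6], [0,1,2,3,4,5,6,7],
    [(40,4526317), (17,456217), (26,346127), (17,456317), (26,246137), (17,456217), (16,126547),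
    (49,5264317), (21,742531), (25,534217), (21,743521), (25,524317), (28,162547), (29,546271),
    (16,126457), (49,4265317), (21,752431), (25,435217), (21,753421), (25,425317), (28,162457),
    (29,456271), (50,1263457), (26,136247), (31,364527), (26,126347), (31,264537), (30,745261),
    (17,452617), (17,453617), (29,712634), (17,452617), (29,713624), (52,1726345), (28,126547),
    (29,524617), (21,742531), (25,534217), (21,743521), (25,524317), (53,5426371), (31,172645),
    (28,126457), (29,425617), (21,752431), (25,435217), (21,753421), (25,425317), (53,4526371),
    (31,172654), (30,745621), (29,724613), (55,1276453), (29,734612), (55,1376452), (57,4526731)],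
    [(35,4526178), (0,46187), (0,42187), (7,452187), (16,126487), (17,456817), (17,452817),
    (0,12487), (24,462178), (26,781264), (24,712648), (29,468217), (26,486217), (29,718264),
    (0,71648), (5,423178), (7,452817), (23,452817), (18,781243), (26,482617), (0,71248),
    (44,4523781), (17,458271), (17,458617), (17,458217), (45,8457231), (53,7426381), (29,724618),
    (30,745281), (16,845721), (55,1786452), (31,764528), (18,874213), (57,4527831), (30,845721),
    (5,123478)]⟩]

set_option maxRecDepth 100000 in
theorem allValid_searchNodes : allValid forbiddenList searchNodes = true := by decide +kernel

theorem forall_isMinimalNonRepresentable :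
    ∀ d ∈ forbiddenList, isMinimalNonRepresentable d = true := by
  rw [← List.all_eq_true]
  decide +kernel

/-! ### The listed graphs are the minimal nonrepresentable graphs -/

theorem maskAdj_edgeMask (E : List ℕ) (i j : ℕ) :
    maskAdj (edgeMask E) i j = true ↔ 10 * (i + 1) + (j + 1) ∈ E := by
  rw [maskAdj, binaryDigit_eq, testBit_edgeMask]
  change 10 * i + (j + 11) ∈ E ↔ _
  rw [show 10 * i + (j + 11) = 10 * (i + 1) + (j + 1) by omega]

theorem listedGraph_adj {d : ℕ × List ℕ} (hd : isMinimalNonRepresentable d = true) {i j : Fin d.1}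
    (hij : i < j) : (listedGraph d).Adj i j ↔ maskAdj (edgeMask d.2) i j = true := by
  simp only [isMinimalNonRepresentable, Bool.and_eq_true, List.all_eq_true, Nat.blt_eq,
    Nat.ble_eq] at hd
  rw [listedGraph, SimpleGraph.fromRel_adj, maskAdj_edgeMask, and_iff_right hij.ne,
    or_iff_left_iff_imp]
  intro h
  -- Labels are at most 8, so a two-digit entry determines its digits. The reversed entry would have
  -- the larger digit first, which the check on the edge list excludes.
  have := hd.1.1.2 _ h
  have := hd.1.1.1
  omega

theorem ContainsCopy.isIndContained {V : Type*} {G : SimpleGraph V} {d : ℕ × List ℕ}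
    (hd : isMinimalNonRepresentable d = true) (h : ContainsCopy G d) :
    (listedGraph d).IsIndContained G := by
  obtain ⟨φ, hφ⟩ := h
  have key : ∀ i j : Fin d.1, i < j →
      φ i ≠ φ j ∧ (G.Adj (φ i) (φ j) ↔ (listedGraph d).Adj i j) := fun i j hij => by
    rw [listedGraph_adj hd hij]
    exact hφ i j hij j.2
  refine ⟨⟨⟨fun i => φ i, fun i j hij => ?_⟩, fun {i j} => ?_⟩⟩
  · by_contra hne
    obtain h | h := lt_or_gt_of_ne hne
    · exact (key i j h).1 hij
    · exact (key j i h).1 hij.symm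
  · obtain h | rfl | h := lt_trichotomy i j
    · exact (key i j h).2
    · simp
    · rw [G.adj_comm, SimpleGraph.adj_comm _ i]
      exact (key j i h).2

theorem not_representable_listedGraph {d : ℕ × List ℕ} (hd : isMinimalNonRepresentable d = true) :
    ¬ Representable (listedGraph d) := by
  rintro ⟨f, hf, h⟩
  have hd' := hd
  simp only [isMinimalNonRepresentable, Bool.and_eq_true, Bool.not_eq_true'] at hd'
  refine Bool.eq_false_iff.1 hd'.1.2 (isRepresentable_iff.2
    ⟨fun i => if hi : i < d.1 then f ⟨i, hi⟩ else 0, fun i hi => ?_, fun i j hij hj => ?_⟩)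
  · simp only [dif_pos hi, hf]
  · have hlt : (⟨i, hij.trans hj⟩ : Fin d.1) < ⟨j, hj⟩ := hij
    simp only [dif_pos hj, dif_pos (hij.trans hj)]
    rw [Bool.eq_iff_iff, ← h _ _ hlt.ne, listedGraph_adj hd hlt]

theorem representable_induce_listedGraph {d : ℕ × List ℕ}
    (hd : isMinimalNonRepresentable d = true) (v : Fin d.1) :
    Representable ((listedGraph d).induce {w | w ≠ v}) := by
  have hd' := hd
  simp only [isMinimalNonRepresentable, Bool.and_eq_true, List.all_eq_true, List.mem_range] at hd'
  obtain ⟨f, hf, h⟩ := isRepresentable_iff.1 (hd'.2 v v.2)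
  have hskip : ∀ w : {w | w ≠ v}, ∃ i < d.1 - 1, skip v i = w := by
    rintro ⟨w, hw⟩
    have hne : (w : ℕ) ≠ v := fun h => hw (Fin.ext h)
    obtain hlt | hlt := hne.lt_or_gt
    · exact ⟨w, by omega, by rw [skip, (Nat.blt_eq ..).mpr hlt, cond_true]⟩
    · refine ⟨w - 1, by omega, ?_⟩
      have : Nat.blt (w - 1) v = false := by
        rw [Bool.eq_false_iff, ne_eq, Nat.blt_eq]; omega
      simp only [skip, this, cond_false]
      omega
  -- The relabelling preserves order, which matters because the coded adjacency is meaningful only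
  -- for increasing pairs.
  have hmono : ∀ i j, skip v i < skip v j → i < j := by
    intro i j hij
    simp only [skip, Bool.cond_eq_ite, Nat.blt_eq] at hij
    split_ifs at hij <;> omega
  choose g hg hgv using hskip
  have key : ∀ a b : {w | w ≠ v}, (a : Fin d.1) < b →
      ((listedGraph d).Adj a b ↔ dot (f (g a)) (f (g b)) = true) := by
    intro a b hab
    rw [listedGraph_adj hd hab, ← h _ _ (hmono _ _ (by rw [hgv, hgv]; exact hab)) (hg b), hgv, hgv]
  refine ⟨fun a => f (g a), fun a => hf _ (hg a), fun a b hab => ?_⟩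
  rw [SimpleGraph.comap_adj]
  obtain hlt | hlt := lt_or_gt_of_ne (Subtype.coe_injective.ne hab)
  · exact key a b hlt
  · rw [SimpleGraph.adj_comm, dot_comm]
    exact key b a hlt

/-- A graph that is not representable contains one of the listed graphs. -/
theorem exists_isIndContained {V : Type*} {G : SimpleGraph V} (hG : ¬ Representable G) :
    ∃ d ∈ forbiddenList, (listedGraph d).IsIndContained G := by
  -- The search starts from a vertex, so the graph without vertices is treated apart.
  obtain _ | _ := isEmpty_or_nonempty V
  · exact absurd ⟨isEmptyElim, isEmptyElim, fun v => isEmptyElim v⟩ hG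
  obtain ⟨d, hd, h⟩ := (representable_or_contains_of_allValid (G := G) allValid_searchNodes
    ⟨_, List.mem_append_left _ List.mem_cons_self, containsCopy_singleton G⟩).resolve_left hG
  exact ⟨d, hd, h.isIndContained (forall_isMinimalNonRepresentable d hd)⟩

theorem isMinimalForbidden_iff {V : Type*} [Fintype V] {H : SimpleGraph V} :
    IsMinimalForbidden (ZMod 2) 3 H ↔
      ¬ Representable H ∧ ∀ v, Representable (H.induce {w | w ≠ v}) := by
  rw [IsMinimalForbidden, Nat.succ_le_iff, ← not_le]
  simp only [minRank_le_three_iff]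

/-- A minimal `H` is not representable, so it contains a listed graph. If the embedding missed a
vertex `v`, the listed graph would embed in `H - v` and be representable; hence the embedding is
onto. -/
theorem isMinimalForbidden_iff_exists_iso {V : Type*} [Fintype V] {H : SimpleGraph V} :
    IsMinimalForbidden (ZMod 2) 3 H ↔ ∃ d ∈ forbiddenList, Nonempty (H ≃g listedGraph d) := by
  rw [isMinimalForbidden_iff]
  constructor
  · rintro ⟨hH, hmin⟩
    obtain ⟨d, hd, ⟨e⟩⟩ := exists_isIndContained hH
    refine ⟨d, hd, ⟨(RelIso.ofSurjective e fun v => ?_).symm⟩⟩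
    by_contra! hv
    let e' : listedGraph d ↪g H.induce {w | w ≠ v} :=
      ⟨⟨fun i => ⟨e i, hv i⟩, fun i j h => e.injective (congrArg Subtype.val h)⟩,
        e.map_adj_iff⟩
    exact not_representable_listedGraph (forall_isMinimalNonRepresentable d hd)
      ((hmin v).of_embedding e')
  · rintro ⟨d, hd, ⟨e⟩⟩
    have hd' := forall_isMinimalNonRepresentable d hd
    refine ⟨fun h => not_representable_listedGraph hd' (h.of_embedding e.symm.toEmbedding),
      fun v => (representable_induce_listedGraph hd' (e v)).of_embedding
        ⟨⟨fun w => ⟨e w, fun h => w.2 (e.injective h)⟩, fun a b h =>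
          Subtype.ext (e.injective (congrArg Subtype.val h))⟩, e.map_adj_iff⟩⟩

theorem representable_iff_forall_not_isIndContained {V : Type*} {G : SimpleGraph V} :
    Representable G ↔ ∀ d ∈ forbiddenList, ¬ (listedGraph d).IsIndContained G := by
  refine ⟨fun hG d hd ⟨e⟩ => not_representable_listedGraph
    (forall_isMinimalNonRepresentable d hd) (hG.of_embedding e), fun h => ?_⟩
  by_contra hG
  obtain ⟨d, hd, hd'⟩ := exists_isIndContained hG
  exact h d hd hd'

/-! ### Pairwise nonisomorphism -/

/-- An isomorphism invariant of the graph with adjacency `a`: the sum over the vertices of powers of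
two, the exponent being the sum of the degrees of the vertex and of its neighbours. -/
def degreeInvariant {V : Type*} [Fintype V] (a : V → V → Bool) : ℕ :=
  ∑ v, 2 ^ (∑ w, (a v w).toNat + ∑ w, ∑ u, (a v w).toNat * (a w u).toNat)

theorem degreeInvariant_eq {V W : Type*} [Fintype V] [Fintype W] {a : V → V → Bool}
    {b : W → W → Bool} (e : V ≃ W) (h : ∀ v w, b (e v) (e w) = a v w) :
    degreeInvariant a = degreeInvariant b := by
  refine Fintype.sum_equiv e _ _ fun v => congrArg (2 ^ ·) (congrArg₂ (· + ·)
    (Fintype.sum_equiv e _ _ fun w => by rw [h])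
    (Fintype.sum_equiv e _ _ fun w => Fintype.sum_equiv e _ _ fun u => by rw [h, h]))

/-- The adjacency of a listed graph. -/
def listedAdj (d : ℕ × List ℕ) (i j : Fin d.1) : Bool :=
  !Nat.beq i j && symmAdj (maskAdj (edgeMask d.2)) i j

theorem listedAdj_eq_true_iff {d : ℕ × List ℕ} (hd : isMinimalNonRepresentable d = true)
    (i j : Fin d.1) : listedAdj d i j = true ↔ (listedGraph d).Adj i j := by
  rw [listedAdj, Bool.and_eq_true, Bool.not_eq_true', Bool.eq_false_iff, ne_eq, Nat.beq_eq,
    symmAdj]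
  simp only [Bool.cond_eq_ite, Nat.blt_eq]
  obtain h | rfl | h := lt_trichotomy i j
  · rw [listedGraph_adj hd h, if_pos (Fin.lt_def.1 h)]
    exact and_iff_right (Fin.val_injective.ne h.ne)
  · simp
  · rw [SimpleGraph.adj_comm, listedGraph_adj hd h, if_neg (not_lt.2 (Fin.le_def.1 h.le))]
    exact and_iff_right (Fin.val_injective.ne h.ne')

/-- The invariant is not claimed to be complete in general; it happens to separate these 62 graphs.
-/
theorem pairwise_degreeInvariant_ne : forbiddenList.Pairwise
    fun d e => degreeInvariant (listedAdj d) ≠ degreeInvariant (listedAdj e) := by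
  decide +kernel

theorem pairwise_isEmpty_iso :
    forbiddenList.Pairwise fun d e => IsEmpty (listedGraph d ≃g listedGraph e) := by
  refine pairwise_degreeInvariant_ne.imp_of_mem fun {d e} hd he hne => ⟨fun φ => hne ?_⟩
  refine degreeInvariant_eq φ.toEquiv fun i j => ?_
  rw [Bool.eq_iff_iff, listedAdj_eq_true_iff (forall_isMinimalNonRepresentable e he),
    listedAdj_eq_true_iff (forall_isMinimalNonRepresentable d hd)]
  exact φ.map_adj_iff

/-! ### The main theorem -/

theorem mainTheorem2 :
    forbiddenList.length = 62 ∧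
    forbiddenList.Pairwise (fun d e => IsEmpty (listedGraph d ≃g listedGraph e)) ∧
    (∀ (V : Type u) [Fintype V] (H : SimpleGraph V),
      IsMinimalForbidden (ZMod 2) 3 H ↔ ∃ d ∈ forbiddenList, Nonempty (H ≃g listedGraph d)) ∧
    (∀ (V : Type u) [Fintype V] (G : SimpleGraph V),
      minRank (ZMod 2) G ≤ 3 ↔
        ∀ (W : Type u) [Fintype W] (H : SimpleGraph W),
          IsMinimalForbidden (ZMod 2) 3 H → ¬ H.IsIndContained G) ∧
    (∀ (V : Type u) [Fintype V] (G : SimpleGraph V),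
      minRank (ZMod 2) G ≤ 3 ↔ ∀ d ∈ forbiddenList, ¬ (listedGraph d).IsIndContained G) := by
  refine ⟨rfl, pairwise_isEmpty_iso, fun V _ H => isMinimalForbidden_iff_exists_iso,
    fun V _ G => ?_, fun V _ G => ?_⟩
  · rw [minRank_le_three_iff, representable_iff_forall_not_isIndContained]
    constructor
    · rintro h W _ H hH hHG
      obtain ⟨d, hd, ⟨e⟩⟩ := isMinimalForbidden_iff_exists_iso.1 hH
      exact h d hd (SimpleGraph.IsIndContained.trans ⟨e.symm.toEmbedding⟩ hHG)
    · rintro h d hd hdG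
      -- The listed graphs live on types in the lowest universe, whereas `W` ranges over `Type u`; a
      -- lifted copy bridges the difference.
      let e : (listedGraph d).comap Equiv.ulift.{u, 0} ≃g listedGraph d :=
        SimpleGraph.Iso.comap _ _
      exact h _ _ (isMinimalForbidden_iff_exists_iso.2 ⟨d, hd, ⟨e⟩⟩)
        (SimpleGraph.IsIndContained.trans ⟨e.toEmbedding⟩ hdG)
  · rw [minRank_le_three_iff, representable_iff_forall_not_isIndContained]
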